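/- **Environment.** Let $I$ be a finite set of $n$ players. Each player $i\in I$ has a finite action set $A_i$ with at least two elements; put $A=\prod_{i\in I}A_i$, and let $u_i:A\to\mathbb R$ be the payoff of $i$. An action $b\in A_i$ is *strictly dominated* if there is a mixed action $\beta\in\Delta(A_i)$ with $u_i(b,a_{-i})<\sum_{c\in A_i}\beta(c)\,u_i(c,a_{-i})$ for all $a_{-i}\in A_{-i}$. **Interdependent-choice equilibrium.** Let $R$ be the set of enumerations $r:I\to\{1,\dots,n\}$ (bijections) of the players. A distribution $\alpha\in\Delta(A)$ is an *interdependent-choice equilibrium* (ICE) if there is $\theta:A\to\Delta(R)$ such that for every player $i$ and all $b,c\in A_i$ $$\sum_{a\in A,\ a_i=b}\alpha(a)\Big(u_i(a)-\sum_{r\in R}\theta(r\mid a)\,\underline w_i(c;a,r)\Big)\ \ge\ 0,$$ where $\underline w_i(c;a,r)=\min\{u_i(a') : a'\in A,\ a'_i=c,\ a'_j=a_j \text{ whenever } r(j)<r(i)\}$. (For two players, $\theta$ is the distribution of the first mover, and a player who deviates receives his worst possible payoff if he is first, and faces $a_{-i}$ if he is second.) **Mechanisms.** Consider finite extensive form games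 with perfect recall and player set $I$, in which Nature may assign probability zero to some of its available moves. Let $v$ be the payoffs at terminal nodes, and let $\tau$ be a map from the terminal nodes onto $A$ with $v_i(z)=u_i(\tau(z))$ for all $z$ and $i$. A move $m$ at a decision node $y$ of player $i$ *represents* $b\in A_i$ if $\tau_i(z)=b$ for every terminal $z$ after $(y,m)$, and $\tau_i(z)\ne b$ for some terminal $z$ after $y$. A decision node of $i$ is *pivotal* if every $b\in A_i$ is represented there by some move. The game with $\tau$ is an *extensive form mechanism* if at all nodes of an information set the same moves represent the same actions, and if for every terminal node $z$ and every player $i$ the path to $z$ contains a pivotal node of $i$ at which the move on that path represents $\tau_i(z)$. **Implementation.** A distribution $\alpha\in\Delta(A)$ is *Nash* (respectively *sequentially*) *implementable* if there are an extensive form mechanism and a Nash equilibrium in mixed strategies (respectively a sequential equilibrium) of it such that, for every $a\in A$, the probability that the game ends at a terminal node $z$ with $\tau(z)=a$ is $\alpha(a)$. Here a *sequential equilibrium* consists of behavior strategies $\sigma$ and beliefs $\psi$ over the nodes of each information set that are - *sequentially rational*: at every information set, every move that has positive probability under $\sigma$ maximizes the expected payoff of the player moving there, among the available moves, given $\psi$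 and later play according to $\sigma$; and - *consistent*: there is one sequence of behavior of the players and of Nature that gives positive probability to every available move, converges to $\sigma$ and to the actual behavior of Nature, and whose beliefs by Bayes' rule converge to $\psi$. **Corollary.** If no action of any player is strictly dominated, then a distribution $\alpha\in\Delta(A)$ is sequentially implementable if and only if it is an interdependent-choice equilibrium. Moreover, $\alpha$ is Nash implementable if and only if it is sequentially implementable. -/

import Mathlib

open Filter Topology

universe w

noncomputable section

namespace ChoiceInterdependence

/-! ### Finite extensive form games with perfect recall -/

/-- The tree and information structure of a finite extensive form game with player set `I`, set of
moves `M` and set of information sets `H`. Nodes are histories, that is, finite sequences of moves.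
At a non-terminal node `x`, `infoSet x = none` means that Nature moves, and `infoSet x = some h`
means that `x` lies in the information set `h`, where the player `owner h` moves. The values of
`infoSet` at terminal nodes and outside `nodes` play no role. -/
structure GameTree (I M H : Type w) where
  nodes : Finset (List M)
  root_mem : [] ∈ nodes
  prefix_mem : ∀ (x : List M) (m : M), x ++ [m] ∈ nodes → x ∈ nodes
  infoSet : List M → Option H
  owner : H → I

namespace GameTree

variable {I M H : Type w} [Fintype M] [Fintype H] (G : GameTree I M H)

open Classical in
/-- The moves available at a node. -/
def moves (x : List M) : Finset M :=
  Finset.univ.filter fun m => x ++ [m] ∈ G.nodes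

open Classical in
/-- The terminal nodes. -/
def terminals : Finset (List M) :=
  G.nodes.filter fun x => G.moves x = ∅

open Classical in
/-- The nodes at which Nature moves. -/
def natureNodes : Finset (List M) :=
  G.nodes.filter fun x => (G.moves x).Nonempty ∧ G.infoSet x = none

open Classical in
/-- The decision nodes that belong to the information set `h`. -/
def nodesOf (h : H) : Finset (List M) :=
  G.nodes.filter fun x => (G.moves x).Nonempty ∧ G.infoSet x = some h

open Classical in
/-- The terminal nodes that can be reached after the node `x`. -/
def terminalsAfter (x : List M) : Finset (List M) :=
  G.terminals.filter fun z => x <+: z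

open Classical in
/-- The moves available at an information set (at some, equivalently all, of its nodes). -/
def movesAt (h : H) : Finset M :=
  Finset.univ.filter fun m => ∃ x ∈ G.nodesOf h, m ∈ G.moves x

open Classical in
/-- What player `i` observes and does along the moves `l` played from the node `x` on: the
information sets of `i` that are met, with the moves made there, in order. -/
def experienceFrom (i : I) : List M → List M → List (H × M)
  | _, [] => []
  | x, m :: l =>
    (match G.infoSet x with
      | none => []
      | some h => if G.owner h = i then [(h, m)] else []) ++ experienceFrom i (x ++ [m]) l

/-- The experience of player `i` on the way to the node `x`. -/
def experience (i : I) (x : List M) : List (H × M) :=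
  G.experienceFrom i [] x

/-- Behavior of Nature: at every node of Nature, a distribution over the available moves. Values
at other arguments play no role. -/
def IsNatureBehavior (χ : List M → M → ℝ) : Prop :=
  ∀ x ∈ G.natureNodes, (∀ m ∈ G.moves x, 0 ≤ χ x m) ∧ ∑ m ∈ G.moves x, χ x m = 1

/-- A profile of behavior strategies of the players: at every information set, a distribution over
the available moves. As each information set has one owner, the strategies of all the players
are collected in one function. -/
def IsBehavior (σ : H → M → ℝ) : Prop :=
  ∀ h, (∀ m ∈ G.movesAt h, 0 ≤ σ h m) ∧ ∑ m ∈ G.movesAt h, σ h m = 1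

/-- Probability of the move `m` at the node `x`. -/
def stepProb (χ : List M → M → ℝ) (σ : H → M → ℝ)
    (x : List M) (m : M) : ℝ :=
  match G.infoSet x with
  | none => χ x m
  | some h => σ h m

/-- Probability that, from the node `x` on, the moves in `l` are made in order. -/
def pathProb (χ : List M → M → ℝ) (σ : H → M → ℝ) :
    List M → List M → ℝ
  | _, [] => 1
  | x, m :: l => G.stepProb χ σ x m * pathProb χ σ (x ++ [m]) l

/-- Probability that the node `x` is reached. -/
def nodeProb (χ : List M → M → ℝ) (σ : H → M → ℝ) (x : List M) : ℝ :=
  G.pathProb χ σ [] x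

end GameTree

/-- A finite extensive form game with perfect recall. Nature may assign probability zero to some
of its available moves. -/
structure ExtensiveGame (I M H : Type w) [Fintype M] [Fintype H] extends GameTree I M H where
  /-- information sets are nonempty -/
  info_nonempty : ∀ h, (toGameTree.nodesOf h).Nonempty
  /-- the same moves are available at all nodes of an information set -/
  info_moves : ∀ h, ∀ x ∈ toGameTree.nodesOf h, ∀ y ∈ toGameTree.nodesOf h,
    toGameTree.moves x = toGameTree.moves y
  perfect_recall : ∀ h, ∀ x ∈ toGameTree.nodesOf h, ∀ y ∈ toGameTree.nodesOf h,
    toGameTree.experience (owner h) x = toGameTree.experience (owner h) y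
  chance : List M → M → ℝ
  chance_dist : toGameTree.IsNatureBehavior chance
  /-- payoffs at terminal nodes -/
  payoff : List M → I → ℝ

namespace ExtensiveGame

variable {I M H : Type w} [Fintype M] [Fintype H] (G : ExtensiveGame I M H)

/-! ### Nash equilibrium -/

/-- Pure strategies of player `i`: an available move at each information set of `i`. -/
abbrev PureStrategy (i : I) : Type w :=
  (h : {h : H // G.owner h = i}) → {m : M // m ∈ G.movesAt h.1}

open Classical in
instance (i : I) : Fintype (G.PureStrategy i) :=
  inferInstanceAs
    (Fintype ((h : {h : H // G.owner h = i}) → {m : M // m ∈ G.movesAt h.1}))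

open Classical in
/-- The (degenerate) behavior in which the players follow the pure strategies `s`. -/
def pureBehavior (s : (i : I) → G.PureStrategy i) (h : H) (m : M) : ℝ :=
  if (s (G.owner h) ⟨h, rfl⟩ : M) = m then 1 else 0

/-- Profiles of mixed strategies: a distribution over pure strategies for each player. -/
def IsMixedProfile (μ : (i : I) → G.PureStrategy i → ℝ) : Prop :=
  ∀ i, μ i ∈ stdSimplex ℝ (G.PureStrategy i)

open Classical in
/-- Probability that the node `x` is reached if the players use the mixed strategies `μ`
independently and Nature follows `G.chance`. -/
def mixedNodeProb [Fintype I] (μ : (i : I) → G.PureStrategy i → ℝ) (x : List M) : ℝ :=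
  ∑ s : (i : I) → G.PureStrategy i,
    (∏ i, μ i (s i)) * G.nodeProb G.chance (G.pureBehavior s) x

/-- Expected payoff of player `i` from a profile of mixed strategies. -/
def mixedPayoff [Fintype I] (μ : (i : I) → G.PureStrategy i → ℝ) (i : I) : ℝ :=
  ∑ z ∈ G.terminals, G.mixedNodeProb μ z * G.payoff z i

open Classical in
/-- Nash equilibrium in mixed strategies. -/
def IsNash [Fintype I] (μ : (i : I) → G.PureStrategy i → ℝ) : Prop :=
  G.IsMixedProfile μ ∧
    ∀ i, ∀ ν ∈ stdSimplex ℝ (G.PureStrategy i),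
      G.mixedPayoff (Function.update μ i ν) i ≤ G.mixedPayoff μ i

/-! ### Sequential equilibrium -/

/-- Expected payoff of player `i` once the node `x` is reached, if the players follow `σ` from
there on. -/
def continuationPayoff (σ : H → M → ℝ) (i : I) (x : List M) : ℝ :=
  ∑ z ∈ G.terminalsAfter x, G.pathProb G.chance σ x (z.drop x.length) * G.payoff z i

/-- Expected payoff, for the player who moves at the information set `h`, from choosing the move
`m` there, given the beliefs `ψ h` over the nodes of `h` and future play according to `σ`. -/
def interimPayoff (ψ : H → List M → ℝ) (σ : H → M → ℝ)
    (h : H) (m : M) : ℝ :=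
  ∑ y ∈ G.nodesOf h, ψ h y * G.continuationPayoff σ (G.owner h) (y ++ [m])

/-- Every move that is chosen with positive probability at an information set is optimal there. -/
def IsSequentiallyRational (ψ : H → List M → ℝ) (σ : H → M → ℝ) : Prop :=
  ∀ h, ∀ m ∈ G.movesAt h, 0 < σ h m →
    ∀ m' ∈ G.movesAt h, G.interimPayoff ψ σ h m' ≤ G.interimPayoff ψ σ h m

/-- Consistency: there is one sequence of strictly mixed behavior `σ' n` of the players and
`χ' n` of Nature, converging to `σ` and to Nature's actual behavior, such that the beliefs
obtained from it by Bayes' rule converge to `ψ`. The trembles of Nature allow the players to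
explain an unexpected event by a move to which Nature assigns probability zero. -/
def IsConsistent (ψ : H → List M → ℝ) (σ : H → M → ℝ) : Prop :=
  ∃ (σ' : ℕ → H → M → ℝ) (χ' : ℕ → List M → M → ℝ),
    (∀ n, G.IsBehavior (σ' n) ∧ ∀ h, ∀ m ∈ G.movesAt h, 0 < σ' n h m) ∧
    (∀ n, G.IsNatureBehavior (χ' n) ∧ ∀ x ∈ G.natureNodes, ∀ m ∈ G.moves x, 0 < χ' n x m) ∧
    (∀ h, ∀ m ∈ G.movesAt h, Tendsto (fun n => σ' n h m) atTop (𝓝 (σ h m))) ∧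
    (∀ x ∈ G.natureNodes, ∀ m ∈ G.moves x,
      Tendsto (fun n => χ' n x m) atTop (𝓝 (G.chance x m))) ∧
    (∀ h, ∀ y ∈ G.nodesOf h,
      Tendsto (fun n => G.nodeProb (χ' n) (σ' n) y /
          ∑ y' ∈ G.nodesOf h, G.nodeProb (χ' n) (σ' n) y')
        atTop (𝓝 (ψ h y)))

/-- Sequential equilibrium: a sequentially rational and consistent assessment. -/
def IsSequentialEquilibrium (ψ : H → List M → ℝ) (σ : H → M → ℝ) : Prop :=
  G.IsBehavior σ ∧ G.IsConsistent ψ σ ∧ G.IsSequentiallyRational ψ σ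

/-! ### Extensive form mechanisms

The environment has players `I`, action sets `A i` and payoffs `u i a`; `τ` assigns an action
profile to each terminal node. -/

variable {A : I → Type w}

/-- `τ` maps the terminal nodes onto the action profiles and preserves payoffs. -/
def IsOutcomeHom (u : I → ((i : I) → A i) → ℝ) (τ : List M → (i : I) → A i) : Prop :=
  (∀ a, ∃ z ∈ G.terminals, τ z = a) ∧ ∀ z ∈ G.terminals, ∀ i, G.payoff z i = u i (τ z)

/-- `y` is a decision node of player `i`. -/
def IsDecisionNode (i : I) (y : List M) : Prop :=
  ∃ h, G.owner h = i ∧ y ∈ G.nodesOf h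

/-- The move `m` represents the action `b` of player `i` at the node `y`: after `m` the outcome for
`i` is `b` in any case, and some other outcome for `i` is still possible at `y`. -/
def Represents (τ : List M → (i : I) → A i) (i : I) (y : List M) (m : M)
    (b : A i) : Prop :=
  m ∈ G.moves y ∧ (∀ z ∈ G.terminalsAfter (y ++ [m]), τ z i = b) ∧
    ∃ m' ∈ G.moves y, ∃ z ∈ G.terminalsAfter (y ++ [m']), τ z i ≠ b

/-- A decision node of player `i` at which every action of `i` is represented by some move. -/
def IsPivotal (τ : List M → (i : I) → A i) (i : I) (y : List M) : Prop :=
  G.IsDecisionNode i y ∧ ∀ b : A i, ∃ m, G.Represents τ i y m b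

/-- Full disclosure of consequences: the same moves represent the same actions at all nodes of an
information set. -/
def FullDisclosure (τ : List M → (i : I) → A i) : Prop :=
  ∀ h, ∀ y ∈ G.nodesOf h, ∀ y' ∈ G.nodesOf h, ∀ m b,
    G.Represents τ (G.owner h) y m b ↔ G.Represents τ (G.owner h) y' m b

/-- Extensive form mechanisms: along every play, every player makes, at a pivotal node, a move that
represents his final action. -/
def IsMechanism (u : I → ((i : I) → A i) → ℝ) (τ : List M → (i : I) → A i) : Prop :=
  G.IsOutcomeHom u τ ∧ G.FullDisclosure τ ∧
    ∀ z ∈ G.terminals, ∀ i, ∃ y m, G.IsPivotal τ i y ∧ G.Represents τ i y m (τ z i) ∧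
      z ∈ G.terminalsAfter (y ++ [m])

end ExtensiveGame

/-! ### Implementation -/

open Classical in
/-- `α` is induced by a Nash equilibrium of an extensive form mechanism. -/
def NashImplementable {I : Type w} [Fintype I] {A : I → Type w}
    (u : I → ((i : I) → A i) → ℝ) (α : ((i : I) → A i) → ℝ) : Prop :=
  ∃ (M H : Type w) (_ : Fintype M) (_ : Fintype H) (G : ExtensiveGame I M H)
    (τ : List M → (i : I) → A i), G.IsMechanism u τ ∧
    ∃ μ, G.IsNash μ ∧
      ∀ a, α a = ∑ z ∈ G.terminals.filter (fun z => τ z = a), G.mixedNodeProb μ z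

open Classical in
/-- `α` is induced by a sequential equilibrium of an extensive form mechanism. -/
def SequentiallyImplementable {I : Type w} {A : I → Type w}
    (u : I → ((i : I) → A i) → ℝ) (α : ((i : I) → A i) → ℝ) : Prop :=
  ∃ (M H : Type w) (_ : Fintype M) (_ : Fintype H) (G : ExtensiveGame I M H)
    (τ : List M → (i : I) → A i), G.IsMechanism u τ ∧
    ∃ ψ σ, G.IsSequentialEquilibrium ψ σ ∧
      ∀ a, α a = ∑ z ∈ G.terminals.filter (fun z => τ z = a), G.nodeProb G.chance σ z

/-! ### Interdependent-choice equilibrium -/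

section ICE

variable {I : Type w} [Fintype I] [DecidableEq I] {A : I → Type w}

/-- Enumerations of the players: `r j < r i` means that `j` moves before `i`. -/
abbrev Enumeration (I : Type w) [Fintype I] : Type w := I ≃ Fin (Fintype.card I)

/-- The effective credible threats of player `j`: the additional threats in `B j` and the actions
that `j` plays with positive probability under `α`. -/
def effectiveThreats (α : ((i : I) → A i) → ℝ) (B : (i : I) → Set (A i)) (j : I) : Set (A j) :=
  B j ∪ {b | ∃ a, 0 < α a ∧ a j = b}

/-- The worst payoff for player `i` from the action `c` if the players before `i` (in the order
`r`) have played according to `a` and those after `i` choose effective credible threats. The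
infimum is a minimum, over a finite set that is nonempty if `α` is a distribution. -/
def worstPayoff (u : I → ((i : I) → A i) → ℝ) (α : ((i : I) → A i) → ℝ)
    (B : (i : I) → Set (A i)) (r : Enumeration I) (a : (i : I) → A i) (i : I) (c : A i) : ℝ :=
  sInf (u i '' {b | b i = c ∧ (∀ j, r j < r i → b j = a j) ∧
    ∀ j, r i < r j → b j ∈ effectiveThreats α B j})

variable [∀ i, Fintype (A i)] [∀ i, DecidableEq (A i)]

/-- Incentive compatibility of the mediated mechanism `(α, θ, B)`, where `θ a` is the distribution
of the order in which the players are visited if `a` is to be implemented: a player who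
is recommended `b` cannot gain by choosing `c` instead, if the players visited before him have
complied, those visited after him comply when he does, and punish him when he deviates. -/
def IncentiveCompatible (u : I → ((i : I) → A i) → ℝ) (α : ((i : I) → A i) → ℝ)
    (θ : ((i : I) → A i) → Enumeration I → ℝ) (B : (i : I) → Set (A i)) : Prop :=
  ∀ i, ∀ b c : A i,
    0 ≤ ∑ a ∈ Finset.univ.filter (fun a : (i : I) → A i => a i = b),
      α a * (u i a - ∑ r, θ a r * worstPayoff u α B r a i c)

/-- Interdependent-choice equilibrium with respect to the credible threats `B`. -/
def IsICEWith (u : I → ((i : I) → A i) → ℝ) (B : (i : I) → Set (A i))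
    (α : ((i : I) → A i) → ℝ) : Prop :=
  α ∈ stdSimplex ℝ ((i : I) → A i) ∧
    ∃ θ : ((i : I) → A i) → Enumeration I → ℝ,
      (∀ a, θ a ∈ stdSimplex ℝ (Enumeration I)) ∧ IncentiveCompatible u α θ B

/-- Interdependent-choice equilibrium: all actions are credible threats. -/
def IsICE (u : I → ((i : I) → A i) → ℝ) (α : ((i : I) → A i) → ℝ) : Prop :=
  IsICEWith u (fun _ => Set.univ) α

/-- The action `b` of player `i` is strictly dominated by a mixed action `β`. -/
def StrictlyDominated (u : I → ((i : I) → A i) → ℝ) (i : I) (b : A i) : Prop :=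
  ∃ β ∈ stdSimplex ℝ (A i), ∀ a : (i : I) → A i,
    u i (Function.update a i b) < ∑ c, β c * u i (Function.update a i c)

end ICE

end ChoiceInterdependence

end

/-! Both kinds of implementability are compared with interdependent-choice equilibrium (ICE), never
directly with each other.

Implementable implies ICE (`SequentiallyImplementable.isICE`, `NashImplementable.isICE`). Along a
play every player settles his action at a pivotal node. Nodes have one owner, so these nodes lie at
different depths and order the players (`exists_orderedBy`). If `i` settles on `b`, he could have
chosen at the same node a move that represents `c`. The players before him have settled already and
keep their actions, so whatever happens afterwards he gets at least the worst payoff for that order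
(`OrderedBy.worstPayoff_le`). Full disclosure makes this deviation feasible at information sets.
Optimality then gives the ICE inequality, where θ is the conditional distribution of the order given
the outcome (`isICE_of_plays`).

ICE implies implementable. From α and θ a mediator is built who draws `(a, r)` with probability `α a
* θ a r`, visits the players in the order `r`, and recommends actions: those of `a` until somebody
departs, then those of a profile that is worst for the first deviator. For Nash equilibrium the ICE
inequality is all that is needed.

For sequential equilibrium the punishers must be willing to obey. A recommendation to punish looks
like any other. If the recommended `b` occurs under α, its recipient believes that nobody has
deviated, and the ICE inequality applies. Otherwise `b` is undominated, hence a best response to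
some belief over profiles (`exists_belief_of_not_strictlyDominated`, from Gordan's alternative).
That belief is produced by states of probability zero, in which the recipient moves last and the
others, told nothing, tremble to the required profile. One more null state per player gives the
message "nothing" a definite belief of its own. Trembles of graded orders in a scale ε, with N the
number of players, make the beliefs consistent: ε for the state behind silence and for trembles
after silence; ε^(N+2), divided by the probability of the required trembles, for the justifying
states; ε^(N+3) for trembles after recommendations and for the perturbation of ordinary states
(`tendsto_uninformed`, `tendsto_onPath`, `tendsto_offPath`). -/

set_option linter.unusedSectionVars false

namespace ChoiceInterdependence

/-! ### Game trees: reach probabilities, expectations and backward induction -/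

namespace GameTree

variable {I M H : Type w} [Fintype M] [Fintype H] (G : GameTree I M H)

theorem mem_moves {x : List M} {m : M} : m ∈ G.moves x ↔ x ++ [m] ∈ G.nodes := by
  simp [moves]

theorem mem_terminals {x : List M} : x ∈ G.terminals ↔ x ∈ G.nodes ∧ G.moves x = ∅ := by
  simp [terminals]

theorem mem_natureNodes {x : List M} :
    x ∈ G.natureNodes ↔ x ∈ G.nodes ∧ (G.moves x).Nonempty ∧ G.infoSet x = none := by
  simp [natureNodes]

theorem mem_nodesOf {h : H} {x : List M} :
    x ∈ G.nodesOf h ↔ x ∈ G.nodes ∧ (G.moves x).Nonempty ∧ G.infoSet x = some h := by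
  simp [nodesOf]

theorem mem_terminalsAfter {x z : List M} :
    z ∈ G.terminalsAfter x ↔ z ∈ G.terminals ∧ x <+: z := by
  simp [terminalsAfter]

theorem mem_movesAt {h : H} {m : M} :
    m ∈ G.movesAt h ↔ ∃ x ∈ G.nodesOf h, m ∈ G.moves x := by
  simp [movesAt]

theorem mem_nodes_of_prefix {x y : List M} (hxy : x <+: y) (hy : y ∈ G.nodes) : x ∈ G.nodes := by
  obtain ⟨l, rfl⟩ := hxy
  induction l using List.reverseRecOn with
  | nil => simpa using hy
  | append_singleton l m ih =>
    rw [← List.append_assoc] at hy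
    exact ih (G.prefix_mem _ _ hy)

theorem terminalsAfter_nil : G.terminalsAfter [] = G.terminals := by
  ext z; simp [mem_terminalsAfter]

theorem terminalsAfter_of_terminal {x : List M} (hx : x ∈ G.terminals) :
    G.terminalsAfter x = {x} := by
  ext z
  rw [mem_terminalsAfter, Finset.mem_singleton]
  constructor
  · rintro ⟨hz, l, rfl⟩
    cases l with
    | nil => simp
    | cons m l =>
      have h1 : x ++ [m] ∈ G.nodes :=
        G.mem_nodes_of_prefix ⟨l, by simp⟩ (G.mem_terminals.1 hz).1
      have h2 := G.mem_moves.2 h1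
      rw [(G.mem_terminals.1 hx).2] at h2
      simp at h2
  · rintro rfl
    exact ⟨hx, List.prefix_rfl⟩

/-- Expectation of `f` at the terminal node that is reached from the node `x`. -/
noncomputable def expectFrom (χ : List M → M → ℝ) (σ : H → M → ℝ) (x : List M)
    (f : List M → ℝ) : ℝ :=
  ∑ z ∈ G.terminalsAfter x, G.pathProb χ σ x (z.drop x.length) * f z

variable (χ : List M → M → ℝ) (σ : H → M → ℝ)

theorem expectFrom_of_terminal {x : List M} (hx : x ∈ G.terminals) (f : List M → ℝ) :
    G.expectFrom χ σ x f = f x := by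
  simp [expectFrom, G.terminalsAfter_of_terminal hx, pathProb]

open Classical in
theorem terminalsAfter_eq_biUnion {x : List M} (hne : (G.moves x).Nonempty) :
    G.terminalsAfter x = (G.moves x).biUnion fun m => G.terminalsAfter (x ++ [m]) := by
  ext z
  simp only [Finset.mem_biUnion, mem_terminalsAfter]
  constructor
  · rintro ⟨hz, l, rfl⟩
    cases l with
    | nil =>
      have := (G.mem_terminals.1 hz).2
      simp only [List.append_nil] at this
      simp [this] at hne
    | cons m l =>
      have h1 : x ++ [m] <+: x ++ m :: l := ⟨l, by simp⟩
      exact ⟨m, G.mem_moves.2 (G.mem_nodes_of_prefix h1 (G.mem_terminals.1 hz).1), hz, h1⟩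
  · rintro ⟨m, _, hz, h⟩
    exact ⟨hz, (List.prefix_append x [m]).trans h⟩

theorem expectFrom_step {x : List M} (hne : (G.moves x).Nonempty) (f : List M → ℝ) :
    G.expectFrom χ σ x f =
      ∑ m ∈ G.moves x, G.stepProb χ σ x m * G.expectFrom χ σ (x ++ [m]) f := by
  classical
  rw [expectFrom, G.terminalsAfter_eq_biUnion hne, Finset.sum_biUnion]
  · refine Finset.sum_congr rfl fun m _ => ?_
    rw [expectFrom, Finset.mul_sum]
    refine Finset.sum_congr rfl fun z hz => ?_
    obtain ⟨l, rfl⟩ := (G.mem_terminalsAfter.1 hz).2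
    rw [List.drop_left, List.append_assoc, List.drop_left]
    simp [pathProb, mul_assoc]
  · intro m _ m' _ hmm
    rw [Function.onFun, Finset.disjoint_left]
    intro z hz hz'
    obtain ⟨l, rfl⟩ := (G.mem_terminalsAfter.1 hz).2
    obtain ⟨l', hl'⟩ := (G.mem_terminalsAfter.1 hz').2
    simp only [List.append_assoc, List.append_cancel_left_eq] at hl'
    simp at hl'
    exact hmm hl'.1.symm

theorem pathProb_append (x l l' : List M) :
    G.pathProb χ σ x (l ++ l') = G.pathProb χ σ x l * G.pathProb χ σ (x ++ l) l' := by
  induction l generalizing x with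
  | nil => simp [pathProb]
  | cons m l ih => simp [pathProb, ih, mul_assoc]

theorem nodeProb_append (x l : List M) :
    G.nodeProb χ σ (x ++ l) = G.nodeProb χ σ x * G.pathProb χ σ x l := by
  rw [nodeProb, pathProb_append, nodeProb, List.nil_append]

theorem nodeProb_append_singleton (x : List M) (m : M) :
    G.nodeProb χ σ (x ++ [m]) = G.nodeProb χ σ x * G.stepProb χ σ x m := by
  rw [nodeProb_append]; simp [pathProb]

theorem nodeProb_mul_pathProb {x z : List M} (h : x <+: z) :
    G.nodeProb χ σ x * G.pathProb χ σ x (z.drop x.length) = G.nodeProb χ σ z := by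
  obtain ⟨l, rfl⟩ := h
  rw [List.drop_left, nodeProb_append]

theorem expectFrom_nil (f : List M → ℝ) :
    G.expectFrom χ σ [] f = ∑ z ∈ G.terminals, G.nodeProb χ σ z * f z := by
  simp [expectFrom, terminalsAfter_nil, nodeProb]

/-- Backward induction. -/
theorem backward_induction {P : List M → Prop}
    (h : ∀ x ∈ G.nodes, (∀ m ∈ G.moves x, P (x ++ [m])) → P x) : ∀ x ∈ G.nodes, P x := by
  -- `k` bounds the number of levels left below `x`. For `k = 0` the bound would make `x` longer
  -- than the longest node.
  have key : ∀ k : ℕ, ∀ x ∈ G.nodes, G.nodes.sup List.length + 1 ≤ k + x.length → P x := by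
    intro k
    induction k with
    | zero =>
      intro x hx hk
      have := Finset.le_sup (f := List.length) hx
      omega
    | succ k ih =>
      intro x hx hk
      exact h x hx fun m hm => ih _ (G.mem_moves.1 hm) (by rw [List.length_append, List.length_singleton]; omega)
  intro x hx
  exact key (G.nodes.sup List.length + 1) x hx (by omega)

end GameTree

namespace ExtensiveGame

variable {I M H : Type w} [Fintype M] [Fintype H] (G : ExtensiveGame I M H)

theorem movesAt_eq {h : H} {x : List M} (hx : x ∈ G.nodesOf h) : G.movesAt h = G.moves x := by
  ext m
  rw [GameTree.mem_movesAt]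
  constructor
  · rintro ⟨y, hy, hm⟩
    rwa [G.info_moves h x hx y hy]
  · exact fun hm => ⟨x, hx, hm⟩

variable {G} {χ : List M → M → ℝ} {σ : H → M → ℝ}

theorem stepProb_nonneg (hχ : G.IsNatureBehavior χ) (hσ : G.IsBehavior σ) {x : List M} {m : M}
    (hx : x ∈ G.nodes) (hm : m ∈ G.moves x) : 0 ≤ G.stepProb χ σ x m := by
  rw [GameTree.stepProb]
  split
  · rename_i h
    exact (hχ x (G.mem_natureNodes.2 ⟨hx, ⟨m, hm⟩, h⟩)).1 m hm
  · rename_i h hh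
    have hx' := G.mem_nodesOf.2 ⟨hx, ⟨m, hm⟩, hh⟩
    exact (hσ h).1 m (by rwa [G.movesAt_eq hx'])

theorem sum_stepProb (hχ : G.IsNatureBehavior χ) (hσ : G.IsBehavior σ) {x : List M}
    (hx : x ∈ G.nodes) (hne : (G.moves x).Nonempty) :
    ∑ m ∈ G.moves x, G.stepProb χ σ x m = 1 := by
  unfold GameTree.stepProb
  split
  · rename_i h
    exact (hχ x (G.mem_natureNodes.2 ⟨hx, hne, h⟩)).2
  · rename_i h hh
    have hx' := G.mem_nodesOf.2 ⟨hx, hne, hh⟩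
    have := (hσ h).2
    rwa [G.movesAt_eq hx'] at this

theorem pathProb_nonneg (hχ : G.IsNatureBehavior χ) (hσ : G.IsBehavior σ) {x l : List M}
    (hx : x ++ l ∈ G.nodes) : 0 ≤ G.pathProb χ σ x l := by
  induction l generalizing x with
  | nil => simp [GameTree.pathProb]
  | cons m l ih =>
    have h1 : x ++ [m] ∈ G.nodes := G.mem_nodes_of_prefix ⟨l, by simp⟩ hx
    exact mul_nonneg (stepProb_nonneg hχ hσ (G.prefix_mem _ _ h1) (G.mem_moves.2 h1))
      (ih (by simpa using hx))

theorem nodeProb_nonneg (hχ : G.IsNatureBehavior χ) (hσ : G.IsBehavior σ) {x : List M}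
    (hx : x ∈ G.nodes) : 0 ≤ G.nodeProb χ σ x :=
  pathProb_nonneg hχ hσ (by simpa using hx)

theorem expectFrom_const (hχ : G.IsNatureBehavior χ) (hσ : G.IsBehavior σ) (r : ℝ) :
    ∀ x ∈ G.nodes, G.expectFrom χ σ x (fun _ => r) = r := by
  refine G.backward_induction fun x hx ih => ?_
  rcases (G.moves x).eq_empty_or_nonempty with h | h
  · exact G.expectFrom_of_terminal χ σ (G.mem_terminals.2 ⟨hx, h⟩) _
  · rw [G.expectFrom_step χ σ h, Finset.sum_congr rfl fun m hm => by rw [ih m hm],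
      ← Finset.sum_mul, sum_stepProb hχ hσ hx h, one_mul]

theorem pathProb_drop_nonneg (hχ : G.IsNatureBehavior χ) (hσ : G.IsBehavior σ) {x z : List M}
    (hz : z ∈ G.terminalsAfter x) : 0 ≤ G.pathProb χ σ x (z.drop x.length) := by
  obtain ⟨h, l, rfl⟩ := G.mem_terminalsAfter.1 hz
  rw [List.drop_left]
  exact pathProb_nonneg hχ hσ (G.mem_terminals.1 h).1

theorem expectFrom_mono (hχ : G.IsNatureBehavior χ) (hσ : G.IsBehavior σ) {x : List M}
    {f g : List M → ℝ} (h : ∀ z ∈ G.terminalsAfter x, f z ≤ g z) :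
    G.expectFrom χ σ x f ≤ G.expectFrom χ σ x g :=
  Finset.sum_le_sum fun z hz => mul_le_mul_of_nonneg_left (h z hz) (pathProb_drop_nonneg hχ hσ hz)

theorem expectFrom_le (hχ : G.IsNatureBehavior χ) (hσ : G.IsBehavior σ) {x : List M}
    (hx : x ∈ G.nodes) {f : List M → ℝ} {r : ℝ} (h : ∀ z ∈ G.terminalsAfter x, f z ≤ r) :
    G.expectFrom χ σ x f ≤ r :=
  (expectFrom_mono hχ hσ h).trans_eq (expectFrom_const hχ hσ r x hx)

theorem le_expectFrom (hχ : G.IsNatureBehavior χ) (hσ : G.IsBehavior σ) {x : List M}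
    (hx : x ∈ G.nodes) {f : List M → ℝ} {r : ℝ} (h : ∀ z ∈ G.terminalsAfter x, r ≤ f z) :
    r ≤ G.expectFrom χ σ x f :=
  (expectFrom_const hχ hσ r x hx).symm.trans_le (expectFrom_mono hχ hσ h)

/-- The two behaviors need not be related: a constant separates the values of `f` after `x` from
those of `f'` after `x'`. This is why nothing has to be known about play after a deviation. -/
theorem expectFrom_le_expectFrom {χ' : List M → M → ℝ} {σ' : H → M → ℝ}
    (hχ : G.IsNatureBehavior χ) (hσ : G.IsBehavior σ)
    (hχ' : G.IsNatureBehavior χ') (hσ' : G.IsBehavior σ') {x x' : List M}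
    (hx : x ∈ G.nodes) (hx' : x' ∈ G.nodes) {f f' : List M → ℝ}
    (h : ∀ z ∈ G.terminalsAfter x, ∀ z' ∈ G.terminalsAfter x', f z ≤ f' z') :
    G.expectFrom χ σ x f ≤ G.expectFrom χ' σ' x' f' :=
  expectFrom_le hχ hσ hx fun z hz => le_expectFrom hχ' hσ' hx' fun z' hz' => h z hz z' hz'

theorem tendsto_nodeProb {χ' : ℕ → List M → M → ℝ} {σ' : ℕ → H → M → ℝ}
    (hσ : ∀ h, ∀ m ∈ G.movesAt h, Tendsto (fun n => σ' n h m) atTop (𝓝 (σ h m)))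
    (hχ : ∀ x ∈ G.natureNodes, ∀ m ∈ G.moves x,
      Tendsto (fun n => χ' n x m) atTop (𝓝 (χ x m))) {x : List M} (hx : x ∈ G.nodes) :
    Tendsto (fun n => G.nodeProb (χ' n) (σ' n) x) atTop (𝓝 (G.nodeProb χ σ x)) := by
  induction x using List.reverseRecOn with
  | nil => simp [GameTree.nodeProb, GameTree.pathProb]
  | append_singleton x m ih =>
    simp only [GameTree.nodeProb_append_singleton]
    have hx' := G.prefix_mem _ _ hx
    have hm := G.mem_moves.2 hx
    refine (ih hx').mul ?_
    unfold GameTree.stepProb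
    split
    · rename_i h
      exact hχ x (G.mem_natureNodes.2 ⟨hx', ⟨m, hm⟩, h⟩) m hm
    · rename_i h hh
      have hx'' := G.mem_nodesOf.2 ⟨hx', ⟨m, hm⟩, hh⟩
      exact hσ h m (by rwa [G.movesAt_eq hx''])

theorem isBehavior_pureBehavior (s : (i : I) → G.PureStrategy i) :
    G.IsBehavior (G.pureBehavior s) := by
  classical
  intro h
  constructor
  · intro m _
    rw [pureBehavior]; split <;> norm_num
  · unfold pureBehavior
    rw [Finset.sum_ite_eq, if_pos (s (G.owner h) ⟨h, rfl⟩).2]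

theorem continuationPayoff_eq (σ : H → M → ℝ) (i : I) (x : List M) :
    G.continuationPayoff σ i x = G.expectFrom G.chance σ x (fun z => G.payoff z i) := rfl

open Classical in
theorem sum_terminals_mixedNodeProb [Fintype I]
    (μ : (i : I) → G.PureStrategy i → ℝ) (f : List M → ℝ) :
    ∑ z ∈ G.terminals, G.mixedNodeProb μ z * f z =
      ∑ s : (i : I) → G.PureStrategy i,
        (∏ i, μ i (s i)) * G.expectFrom G.chance (G.pureBehavior s) [] f := by
  simp only [mixedNodeProb, Finset.sum_mul, GameTree.expectFrom_nil, Finset.mul_sum]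
  rw [Finset.sum_comm]
  simp only [mul_assoc]

end ExtensiveGame
end ChoiceInterdependence

/-! ### Orders of the players, and ICE from a distribution over plays -/

namespace ChoiceInterdependence

theorem exists_enumeration_of_injective {I : Type w} [Fintype I] {f : I → ℕ}
    (hf : Function.Injective f) : ∃ r : Enumeration I, ∀ i j, r j < r i → f j < f i := by
  classical
  let S : Finset ℕ := Finset.univ.image f
  have hS : S.card = Fintype.card I := by
    rw [Finset.card_image_of_injective _ hf, Finset.card_univ]
  let e := S.orderIsoOfFin hS
  let g : I → S := fun i => ⟨f i, Finset.mem_image_of_mem f (Finset.mem_univ i)⟩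
  have hg : Function.Bijective g := by
    constructor
    · intro i j h
      exact hf (congrArg Subtype.val h)
    · rintro ⟨k, hk⟩
      obtain ⟨i, _, rfl⟩ := Finset.mem_image.1 hk
      exact ⟨i, rfl⟩
  refine ⟨(Equiv.ofBijective g hg).trans e.symm.toEquiv, fun i j h => ?_⟩
  have h' : e.symm (g j) < e.symm (g i) := h
  rw [e.symm.lt_iff_lt] at h'
  exact h'

section ICE

variable {I : Type w} [Fintype I] [DecidableEq I] {A : I → Type w}
  [∀ i, Fintype (A i)] (u : I → ((i : I) → A i) → ℝ)

theorem worstPayoff_univ_le (α : ((i : I) → A i) → ℝ) (r : Enumeration I) (a a' : (i : I) → A i)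
    (i : I) (h : ∀ j, r j < r i → a' j = a j) :
    worstPayoff u α (fun _ => Set.univ) r a i (a' i) ≤ u i a' :=
  csInf_le (Set.toFinite _).bddBelow
    ⟨a', ⟨rfl, h, fun _ _ => Set.mem_union_left _ (Set.mem_univ _)⟩, rfl⟩

theorem exists_worstPayoff_univ (α : ((i : I) → A i) → ℝ) (r : Enumeration I) (a : (i : I) → A i)
    (i : I) (c : A i) : ∃ a' : (i : I) → A i, a' i = c ∧ (∀ j, r j < r i → a' j = a j) ∧
      u i a' = worstPayoff u α (fun _ => Set.univ) r a i c := by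
  have hne : (u i '' {b | b i = c ∧ (∀ j, r j < r i → b j = a j) ∧
      ∀ j, r i < r j → b j ∈ effectiveThreats α (fun _ => Set.univ) j}).Nonempty := by
    refine ⟨_, Function.update a i c, ⟨by simp, fun j hj => ?_, fun _ _ =>
      Set.mem_union_left _ (Set.mem_univ _)⟩, rfl⟩
    rw [Function.update_of_ne]
    rintro rfl
    exact lt_irrefl _ hj
  obtain ⟨a', ⟨h1, h2, _⟩, h3⟩ := hne.csInf_mem (Set.toFinite _)
  exact ⟨a', h1, h2, h3⟩

variable [∀ i, DecidableEq (A i)]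

/-- Incentive compatibility may be checked for a distribution on a finite set of plays, each with
an outcome and an order of the players. -/
theorem isICE_of_plays {Z : Type*} (T : Finset Z) (P : Z → ℝ) (hP : ∀ z ∈ T, 0 ≤ P z)
    (τ : Z → (i : I) → A i) (r : Z → Enumeration I) {α : ((i : I) → A i) → ℝ}
    (hα : α ∈ stdSimplex ℝ ((i : I) → A i)) (hsum : ∀ a, α a = ∑ z ∈ T with τ z = a, P z)
    (h : ∀ i (b c : A i), 0 ≤ ∑ z ∈ T with τ z i = b,
      P z * (u i (τ z) - worstPayoff u α (fun _ => Set.univ) (r z) (τ z) i c)) : IsICE u α := by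
  classical
  -- The order is drawn from its conditional distribution given the outcome. Where `α a = 0` any
  -- order will do, since such profiles carry no weight in the inequalities.
  refine ⟨hα, fun a ρ => if α a = 0 then if ρ = Fintype.equivFin I then 1 else 0
    else (∑ z ∈ T with τ z = a ∧ r z = ρ, P z) / α a, fun a => ?_, fun i b c => ?_⟩
  · by_cases ha : α a = 0
    · simp only [ha, if_true]
      exact ⟨fun ρ => by dsimp only; split <;> norm_num, by simp⟩
    · simp only [ha, if_false]
      refine ⟨fun ρ => div_nonneg (Finset.sum_nonneg fun z hz => hP z (Finset.mem_filter.1 hz).1)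
        (hα.1 a), ?_⟩
      rw [← Finset.sum_div, div_eq_one_iff_eq ha, hsum a, ← Finset.sum_fiberwise _ r]
      simp only [Finset.filter_filter]
  · refine (h i b c).trans_eq ?_
    rw [← Finset.sum_fiberwise_of_maps_to (s := T.filter fun z => τ z i = b)
      (t := Finset.univ.filter fun a : (i : I) → A i => a i = b) (g := τ) (by simp)]
    refine Finset.sum_congr rfl fun a ha => ?_
    rw [Finset.mem_filter] at ha
    have hfil : (T.filter fun z => τ z i = b).filter (fun z => τ z = a) =
        T.filter fun z => τ z = a := by
      ext z
      simp only [Finset.mem_filter]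
      constructor
      · exact fun h => ⟨h.1.1, h.2⟩
      · rintro ⟨h1, rfl⟩
        exact ⟨⟨h1, ha.2⟩, rfl⟩
    rw [hfil]
    have h1 : ∑ z ∈ T with τ z = a,
        P z * (u i (τ z) - worstPayoff u α (fun _ => Set.univ) (r z) (τ z) i c) =
        α a * u i a - ∑ z ∈ T with τ z = a,
          P z * worstPayoff u α (fun _ => Set.univ) (r z) a i c := by
      rw [hsum a, Finset.sum_mul, ← Finset.sum_sub_distrib]
      refine Finset.sum_congr rfl fun z hz => ?_
      rw [(Finset.mem_filter.1 hz).2]; ring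
    rw [h1, mul_sub]
    congr 1
    rw [← Finset.sum_fiberwise _ r, Finset.mul_sum]
    refine Finset.sum_congr rfl fun ρ _ => ?_
    rw [Finset.filter_filter]
    have h2 : ∑ z ∈ T with τ z = a ∧ r z = ρ,
        P z * worstPayoff u α (fun _ => Set.univ) (r z) a i c =
        (∑ z ∈ T with τ z = a ∧ r z = ρ, P z) * worstPayoff u α (fun _ => Set.univ) ρ a i c := by
      rw [Finset.sum_mul]
      refine Finset.sum_congr rfl fun z hz => ?_
      rw [(Finset.mem_filter.1 hz).2.2]
    rw [h2]
    by_cases ha0 : α a = 0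
    -- The plays with a null outcome are themselves null, so the default order is harmless.
    · have h3 : ∑ z ∈ T with τ z = a ∧ r z = ρ, P z ≤ 0 := by
        rw [← ha0, hsum a]
        refine Finset.sum_le_sum_of_subset_of_nonneg ?_ fun z hz _ => hP z (Finset.mem_filter.1 hz).1
        intro z; simp only [Finset.mem_filter]; tauto
      have h4 : 0 ≤ ∑ z ∈ T with τ z = a ∧ r z = ρ, P z :=
        Finset.sum_nonneg fun z hz => hP z (Finset.mem_filter.1 hz).1
      rw [le_antisymm h3 h4, ha0]; simp
    · simp only [ha0, if_false]
      field_simp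

end ICE

/-! ### Pivotal nodes and the order in which a play settles the actions -/

namespace ExtensiveGame

variable {I M H : Type w} [Fintype M] [Fintype H] {G : ExtensiveGame I M H} {A : I → Type w}
  {τ : List M → (i : I) → A i}

/-- Once `b` is settled, no other outcome for `i` remains possible, whereas representing `b` at a
later node requires one. -/
theorem Represents.not_of_prefix {i : I} {y y' : List M} {m m' : M} {b : A i}
    (h : G.Represents τ i y m b) (h' : G.Represents τ i y' m' b) : ¬ y ++ [m] <+: y' := by
  intro hp
  obtain ⟨m₁, _, z, hz, hne⟩ := h'.2.2
  obtain ⟨hz, hp'⟩ := G.mem_terminalsAfter.1 hz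
  exact hne (h.2.1 z (G.mem_terminalsAfter.2
    ⟨hz, hp.trans ((List.prefix_append _ _).trans hp')⟩))

/-- Both moves lie on the path to `z` and so represent the same action. If their depths differed,
the deeper one would come after the action is settled. -/
theorem Represents.unique {i : I} {y y' z : List M} {m m' : M} {b b' : A i}
    (h : G.Represents τ i y m b) (h' : G.Represents τ i y' m' b')
    (hz : z ∈ G.terminalsAfter (y ++ [m])) (hz' : z ∈ G.terminalsAfter (y' ++ [m'])) :
    y = y' ∧ m = m' := by
  obtain rfl : b = b' := (h.2.1 z hz).symm.trans (h'.2.1 z hz')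
  replace hz := (G.mem_terminalsAfter.1 hz).2
  replace hz' := (G.mem_terminalsAfter.1 hz').2
  have hlen : y.length = y'.length := by
    rcases lt_trichotomy y.length y'.length with hl | hl | hl
    · exact absurd (List.prefix_of_prefix_length_le hz ((List.prefix_append _ _).trans hz')
        (by simpa using hl)) (h.not_of_prefix h')
    · exact hl
    · exact absurd (List.prefix_of_prefix_length_le hz' ((List.prefix_append _ _).trans hz)
        (by simpa using hl)) (h'.not_of_prefix h)
  have := (List.prefix_of_prefix_length_le hz hz' (by simp [hlen])).eq_of_length (by simp [hlen])
  simpa using List.append_inj this hlen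

theorem IsDecisionNode.owner_eq {i : I} {y : List M} {h : H} (hd : G.IsDecisionNode i y)
    (hy : G.infoSet y = some h) : G.owner h = i := by
  obtain ⟨h', rfl, hy'⟩ := hd
  have := (G.mem_nodesOf.1 hy').2.2
  rw [hy, Option.some_inj] at this
  rw [this]

/-- The players before `i` in the order of a play have settled their actions when `i` settles
his. -/
def OrderedBy (G : ExtensiveGame I M H) [Fintype I] (τ : List M → (i : I) → A i) (z : List M)
    (r : Enumeration I) : Prop :=
  ∀ i y m b, G.Represents τ i y m b → z ∈ G.terminalsAfter (y ++ [m]) → ∀ j, r j < r i →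
    ∃ y' m', G.Represents τ j y' m' (τ z j) ∧ y' ++ [m'] <+: y

/-- The players are ordered by the depth of the node at which they settle their actions. Two players
cannot share such a node, because a node has one owner. -/
theorem exists_orderedBy [Fintype I] {u : I → ((i : I) → A i) → ℝ} (hG : G.IsMechanism u τ)
    {z : List M} (hz : z ∈ G.terminals) : ∃ r, G.OrderedBy τ z r := by
  choose y m hpiv hrep haft using hG.2.2 z hz
  have hpre : ∀ i, y i ++ [m i] <+: z := fun i => (G.mem_terminalsAfter.1 (haft i)).2
  have hinj : Function.Injective fun i => (y i).length := by
    intro i j hij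
    have h1 : y i = y j := (List.prefix_of_prefix_length_le
      ((List.prefix_append _ _).trans (hpre i)) ((List.prefix_append _ _).trans (hpre j))
      (le_of_eq hij)).eq_of_length hij
    obtain ⟨h, hh, hy⟩ := (hpiv i).1
    rw [h1] at hy
    exact hh.symm.trans ((hpiv j).1.owner_eq (G.mem_nodesOf.1 hy).2.2)
  obtain ⟨r, hr⟩ := exists_enumeration_of_injective hinj
  refine ⟨r, fun i y' m' b hrep' hpre' j hj => ⟨y j, m j, hrep j, ?_⟩⟩
  -- The settling move on a play is unique, so the given move is the chosen one.
  obtain ⟨rfl, rfl⟩ := (hrep i).unique hrep' (haft i) hpre'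
  exact List.prefix_of_prefix_length_le (hpre j) ((List.prefix_append _ _).trans (hpre i))
    (by simpa using hr i j hj)

/-- The predecessors of `i` have settled their actions above `y`, so `z` and `z'` agree on them.
Hence `τ z'` is one of the profiles over which the worst payoff is taken. -/
theorem OrderedBy.worstPayoff_le [Fintype I] [DecidableEq I] [∀ i, Fintype (A i)]
    {z z' : List M} {r : Enumeration I} (hr : G.OrderedBy τ z r) (u : I → ((i : I) → A i) → ℝ)
    (α : ((i : I) → A i) → ℝ) {i : I} {y : List M} {m m' : M} {b c : A i}
    (hm : G.Represents τ i y m b) (hz : z ∈ G.terminalsAfter (y ++ [m]))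
    (hm' : G.Represents τ i y m' c) (hz' : z' ∈ G.terminalsAfter (y ++ [m'])) :
    worstPayoff u α (fun _ => Set.univ) r (τ z) i c ≤ u i (τ z') := by
  rw [← hm'.2.1 z' hz']
  refine worstPayoff_univ_le u α r (τ z) (τ z') i fun j hj => ?_
  obtain ⟨y', m₁, hrep, hpre⟩ := hr i y m b hm hz j hj
  have hz'' := G.mem_terminalsAfter.1 hz'
  exact hrep.2.1 z' (G.mem_terminalsAfter.2
    ⟨hz''.1, hpre.trans ((List.prefix_append _ _).trans hz''.2)⟩)

theorem FullDisclosure.isPivotal (hd : G.FullDisclosure τ) {h : H} {y y' : List M}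
    (hy : y ∈ G.nodesOf h) (hy' : y' ∈ G.nodesOf h) (hp : G.IsPivotal τ (G.owner h) y) :
    G.IsPivotal τ (G.owner h) y' :=
  ⟨⟨h, rfl, hy'⟩, fun b => (hp.2 b).imp fun m hm => (hd h y hy y' hy' m b).1 hm⟩

/-- A move that can be chosen at an information set and represents `c` wherever the information
set is pivotal. -/
theorem FullDisclosure.exists_deviation (hd : G.FullDisclosure τ) (i : I) (c : A i) (h : H) :
    ∃ m, (∃ y ∈ G.nodesOf h, G.IsPivotal τ i y) → ∀ y ∈ G.nodesOf h, G.IsPivotal τ i y →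
      G.Represents τ i y m c := by
  by_cases hp : ∃ y ∈ G.nodesOf h, G.IsPivotal τ i y
  · obtain ⟨y, hy, hpiv⟩ := hp
    obtain rfl := hpiv.1.owner_eq (G.mem_nodesOf.1 hy).2.2
    obtain ⟨m, hm⟩ := hpiv.2 c
    exact ⟨m, fun _ y' hy' _ => (hd h y hy y' hy' m c).1 hm⟩
  · obtain ⟨x, hx⟩ := G.info_nonempty h
    obtain ⟨m, _⟩ := (G.mem_nodesOf.1 hx).2.1
    exact ⟨m, fun h' => absurd h' hp⟩

/-! ### Sequential equilibrium outcomes -/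

/-- On a reached information set, limits of Bayes quotients are the Bayes quotients of the limit.
The multiplied form also covers unreached sets, where both sides vanish. -/
theorem IsConsistent.nodeProb_eq {ψ : H → List M → ℝ} {σ : H → M → ℝ} (hσ : G.IsBehavior σ)
    (hc : G.IsConsistent ψ σ) {h : H} {y : List M} (hy : y ∈ G.nodesOf h) :
    G.nodeProb G.chance σ y = ψ h y * ∑ y' ∈ G.nodesOf h, G.nodeProb G.chance σ y' := by
  obtain ⟨σ', χ', _, _, hlσ, hlχ, hψ⟩ := hc
  have hnode : ∀ x ∈ G.nodesOf h, x ∈ G.nodes := fun x hx => (G.mem_nodesOf.1 hx).1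
  have hl := fun x hx => tendsto_nodeProb (x := x) hlσ hlχ (hnode x hx)
  by_cases h0 : ∑ y' ∈ G.nodesOf h, G.nodeProb G.chance σ y' = 0
  · rw [h0, mul_zero]
    exact (Finset.sum_eq_zero_iff_of_nonneg fun x hx =>
      nodeProb_nonneg G.chance_dist hσ (hnode x hx)).1 h0 y hy
  · rw [tendsto_nhds_unique (hψ h y hy) ((hl y hy).div (tendsto_finsetSum _ hl) h0),
      div_mul_cancel₀ _ h0]

/-- Interim optimality multiplied by the probability of reaching the information set and choosing
`m`. Beliefs disappear, and the inequalities can be added up over information sets. -/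
theorem IsSequentialEquilibrium.sum_nonneg {ψ : H → List M → ℝ} {σ : H → M → ℝ}
    (hE : G.IsSequentialEquilibrium ψ σ) {h : H} {m m' : M} (hm : m ∈ G.movesAt h)
    (hm' : m' ∈ G.movesAt h) :
    0 ≤ ∑ y ∈ G.nodesOf h, G.nodeProb G.chance σ y * σ h m *
      (G.continuationPayoff σ (G.owner h) (y ++ [m]) -
        G.continuationPayoff σ (G.owner h) (y ++ [m'])) := by
  obtain ⟨hσ, hc, hrat⟩ := hE
  have hsum : ∑ y ∈ G.nodesOf h, G.nodeProb G.chance σ y * σ h m *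
      (G.continuationPayoff σ (G.owner h) (y ++ [m]) -
        G.continuationPayoff σ (G.owner h) (y ++ [m'])) =
      (∑ y' ∈ G.nodesOf h, G.nodeProb G.chance σ y') * σ h m *
        (G.interimPayoff ψ σ h m - G.interimPayoff ψ σ h m') := by
    rw [interimPayoff, interimPayoff, ← Finset.sum_sub_distrib, Finset.mul_sum]
    refine Finset.sum_congr rfl fun y hy => ?_
    rw [hc.nodeProb_eq hσ hy]
    ring
  rw [hsum]
  have h1 : 0 ≤ ∑ y' ∈ G.nodesOf h, G.nodeProb G.chance σ y' :=
    Finset.sum_nonneg fun y hy => nodeProb_nonneg G.chance_dist hσ (G.mem_nodesOf.1 hy).1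
  rcases ((hσ h).1 m hm).eq_or_lt with h0 | h0
  · simp [← h0]
  · exact mul_nonneg (mul_nonneg h1 h0.le) (sub_nonneg.2 (hrat h m hm h0 m' hm'))

open Classical in
/-- Plays in which `i` ends up with the action `b` are sorted by the pivotal move that settles
it. -/
theorem IsMechanism.sum_terminals [∀ i, DecidableEq (A i)] {u : I → ((i : I) → A i) → ℝ} (hG : G.IsMechanism u τ)
    (i : I) (b : A i) (F : List M → ℝ) :
    ∑ z ∈ G.terminals with τ z i = b, F z =
      ∑ p ∈ (G.nodes ×ˢ Finset.univ).filter
          (fun p : List M × M => G.IsPivotal τ i p.1 ∧ G.Represents τ i p.1 p.2 b),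
        ∑ z ∈ G.terminalsAfter (p.1 ++ [p.2]), F z := by
  rw [← Finset.sum_biUnion]
  · refine Finset.sum_congr ?_ fun _ _ => rfl
    ext z
    simp only [Finset.mem_filter, Finset.mem_biUnion, Finset.mem_product, Finset.mem_univ, and_true]
    constructor
    · rintro ⟨hz, rfl⟩
      obtain ⟨y, m, hp, hr, hz'⟩ := hG.2.2 z hz i
      exact ⟨(y, m), ⟨G.prefix_mem _ _ (G.mem_moves.1 hr.1), hp, hr⟩, hz'⟩
    · rintro ⟨p, ⟨_, _, hr⟩, hz⟩
      exact ⟨(G.mem_terminalsAfter.1 hz).1, hr.2.1 z hz⟩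
  · intro p hp p' hp' hne
    rw [Function.onFun, Finset.disjoint_left]
    intro z hz hz'
    have h1 := (Finset.mem_filter.1 hp).2.2
    have h2 := (Finset.mem_filter.1 hp').2.2
    obtain ⟨h3, h4⟩ := h1.unique h2 hz hz'
    exact hne (Prod.ext h3 h4)

end ExtensiveGame

open ExtensiveGame

theorem SequentiallyImplementable.isICE {I : Type w} [Fintype I] [DecidableEq I] {A : I → Type w}
    [∀ i, Fintype (A i)] [∀ i, DecidableEq (A i)] {u : I → ((i : I) → A i) → ℝ}
    {α : ((i : I) → A i) → ℝ} (hα : α ∈ stdSimplex ℝ ((i : I) → A i))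
    (h : SequentiallyImplementable u α) : IsICE u α := by
  classical
  obtain ⟨M, H, _, _, G, τ, hG, ψ, σ, hE, hout⟩ := h
  have hσ := hE.1
  let r : List M → Enumeration I := fun z =>
    if hz : z ∈ G.terminals then (exists_orderedBy hG hz).choose else Fintype.equivFin I
  have hr : ∀ z ∈ G.terminals, G.OrderedBy τ z (r z) := fun z hz => by
    simp only [r, hz, dif_pos]
    exact (exists_orderedBy hG hz).choose_spec
  refine isICE_of_plays u G.terminals (G.nodeProb G.chance σ)
    (fun z hz => nodeProb_nonneg G.chance_dist hσ (G.mem_terminals.1 hz).1) τ r hα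
    (fun a => by rw [hout a]; congr) fun i b c => ?_
  -- One deviating move per information set, so that the deviation does not depend on the node
  -- reached.
  choose dev hdev using fun h => hG.2.1.exists_deviation i c h
  rw [hG.sum_terminals i b]
  set S := (G.nodes ×ˢ Finset.univ).filter
    (fun p : List M × M => G.IsPivotal τ i p.1 ∧ G.Represents τ i p.1 p.2 b) with hS
  have hmem : ∀ p, p ∈ S ↔ G.IsPivotal τ i p.1 ∧ G.Represents τ i p.1 p.2 b := by
    intro p
    simp only [hS, Finset.mem_filter, Finset.mem_product, Finset.mem_univ, and_true,
      and_iff_right_iff_imp]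
    exact fun h => G.prefix_mem _ _ (G.mem_moves.1 h.2.1)
  -- The default `p.2` is never used, since pivotal nodes are decision nodes.
  let d : List M × M → M := fun p => (G.infoSet p.1).elim p.2 dev
  have hge : ∑ p ∈ S, G.nodeProb G.chance σ p.1 * G.stepProb G.chance σ p.1 p.2 *
      (G.continuationPayoff σ i (p.1 ++ [p.2]) - G.continuationPayoff σ i (p.1 ++ [d p])) ≤
      ∑ p ∈ S, ∑ z ∈ G.terminalsAfter (p.1 ++ [p.2]), G.nodeProb G.chance σ z *
      (u i (τ z) - worstPayoff u α (fun _ => Set.univ) (r z) (τ z) i c) := by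
    refine Finset.sum_le_sum fun p hp => ?_
    obtain ⟨hpiv, hrep⟩ := (hmem p).1 hp
    obtain ⟨h, rfl, hy⟩ := hpiv.1
    have hd : d p = dev h := by simp only [d, (G.mem_nodesOf.1 hy).2.2, Option.elim]
    have hrep' := hdev h ⟨_, hy, hpiv⟩ _ hy hpiv
    have hnode : p.1 ++ [p.2] ∈ G.nodes := G.mem_moves.1 hrep.1
    rw [hd, ← GameTree.nodeProb_append_singleton, continuationPayoff_eq, continuationPayoff_eq]
    have h1 : ∑ z ∈ G.terminalsAfter (p.1 ++ [p.2]), G.nodeProb G.chance σ z *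
        (u (G.owner h) (τ z) - worstPayoff u α (fun _ => Set.univ) (r z) (τ z) (G.owner h) c) =
        G.nodeProb G.chance σ (p.1 ++ [p.2]) *
          (G.expectFrom G.chance σ (p.1 ++ [p.2]) (fun z => G.payoff z (G.owner h)) -
          G.expectFrom G.chance σ (p.1 ++ [p.2]) (fun z =>
            worstPayoff u α (fun _ => Set.univ) (r z) (τ z) (G.owner h) c)) := by
      rw [GameTree.expectFrom, GameTree.expectFrom, ← Finset.sum_sub_distrib, Finset.mul_sum]
      refine Finset.sum_congr rfl fun z hz => ?_
      obtain ⟨hz1, hz2⟩ := G.mem_terminalsAfter.1 hz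
      rw [← G.nodeProb_mul_pathProb G.chance σ hz2, hG.1.2 z hz1]
      ring
    rw [h1]
    refine mul_le_mul_of_nonneg_left (sub_le_sub_left ?_ _)
      (nodeProb_nonneg G.chance_dist hσ hnode)
    refine expectFrom_le_expectFrom G.chance_dist hσ G.chance_dist hσ hnode
      (G.mem_moves.1 hrep'.1) fun z hz z' hz' => ?_
    rw [hG.1.2 z' (G.mem_terminalsAfter.1 hz').1]
    exact (hr z (G.mem_terminalsAfter.1 hz).1).worstPayoff_le u α hrep hz hrep' hz'
  refine le_trans ?_ hge
  -- The pivotal moves are grouped by information set and move, the units at which sequential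
  -- rationality speaks.
  rw [← Finset.sum_fiberwise S (fun p => (G.infoSet p.1, p.2))]
  refine Finset.sum_nonneg fun q _ => ?_
  rcases (S.filter fun p => (G.infoSet p.1, p.2) = q).eq_empty_or_nonempty with he | ⟨p₀, hp₀⟩
  · rw [he, Finset.sum_empty]
  obtain ⟨hp₁, rfl⟩ := Finset.mem_filter.1 hp₀
  obtain ⟨hpiv, hrep⟩ := (hmem p₀).1 hp₁
  obtain ⟨h, rfl, hy⟩ := hpiv.1
  -- By full disclosure a fiber consists of all nodes of the information set: if a move settles `b`
  -- at one pivotal node, it does so at all of them.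
  have hset : (S.filter fun p => (G.infoSet p.1, p.2) = (G.infoSet p₀.1, p₀.2)) =
      (G.nodesOf h).image fun y => (y, p₀.2) := by
    ext ⟨y, m⟩
    simp only [Finset.mem_filter, Finset.mem_image, Prod.mk.injEq, hmem,
      (G.mem_nodesOf.1 hy).2.2]
    constructor
    · rintro ⟨⟨hpiv', hrep'⟩, h1, rfl⟩
      exact ⟨y, G.mem_nodesOf.2 ⟨G.prefix_mem _ _ (G.mem_moves.1 hrep'.1), ⟨_, hrep'.1⟩, h1⟩,
        rfl, rfl⟩
    · rintro ⟨y', hy', rfl, rfl⟩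
      exact ⟨⟨hG.2.1.isPivotal hy hy' hpiv, (hG.2.1 h _ hy _ hy' _ _).1 hrep⟩,
        (G.mem_nodesOf.1 hy').2.2, rfl⟩
  rw [hset, Finset.sum_image (by intro y _ y' _ h; exact (Prod.ext_iff.1 h).1)]
  have hm : p₀.2 ∈ G.movesAt h := G.mem_movesAt.2 ⟨_, hy, hrep.1⟩
  have hm' : dev h ∈ G.movesAt h := G.mem_movesAt.2
    ⟨_, hy, (hdev h ⟨_, hy, hpiv⟩ _ hy hpiv).1⟩
  refine (hE.sum_nonneg hm hm').trans_eq (Finset.sum_congr rfl fun y hy' => ?_)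
  have h1 := (G.mem_nodesOf.1 hy').2.2
  simp only [d, GameTree.stepProb, h1, Option.elim]

end ChoiceInterdependence

/-! ### Nash equilibrium outcomes are interdependent-choice equilibria -/

namespace ChoiceInterdependence

section Product

variable {I : Type*} [Fintype I] [DecidableEq I] {S : I → Type*} [∀ i, Fintype (S i)]

/-- Replacing one factor of a product distribution by its image under `D`. -/
theorem sum_prod_update_map [∀ i, DecidableEq (S i)] (μ : (i : I) → S i → ℝ) (i : I)
    (D : S i → S i) (F : ((i : I) → S i) → ℝ) :
    ∑ s : (i : I) → S i, (∏ j, Function.update μ i (fun t => ∑ t' with D t' = t, μ i t') j (s j)) *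
        F s =
      ∑ s : (i : I) → S i, (∏ j, μ j (s j)) * F (Function.update s i (D (s i))) := by
  have hprod : ∀ (ν : S i → ℝ) (s : (i : I) → S i), ∏ j, Function.update μ i ν j (s j) =
      ν (s i) * ∏ j ∈ Finset.univ.erase i, μ j (s j) := by
    intro ν s
    rw [← Finset.mul_prod_erase _ _ (Finset.mem_univ i), Function.update_self]
    congr 1
    refine Finset.prod_congr rfl fun j hj => ?_
    rw [Function.update_of_ne (Finset.ne_of_mem_erase hj)]
  simp only [hprod, Finset.sum_mul]
  -- A pair of a profile `s` and a strategy `t` with `D t = s i` is the same as the single profile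
  -- in which `i` plays `t`.
  rw [Finset.sum_sigma']
  refine Finset.sum_bij' (fun p _ => Function.update p.1 i p.2)
    (fun s _ => ⟨Function.update s i (D (s i)), s i⟩) (by simp) (by simp) ?_ (by simp) ?_
  · rintro ⟨s, t⟩ h
    have h' : D t = s i := by simpa using h
    simp [h']
  · rintro ⟨s, t⟩ h
    have h' : D t = s i := by simpa using h
    simp only [Function.update_self, h', Function.update_idem, Function.update_eq_self]
    rw [← Finset.mul_prod_erase _ _ (Finset.mem_univ i), Function.update_self]
    congr 2
    refine Finset.prod_congr rfl fun j hj => ?_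
    rw [Function.update_of_ne (Finset.ne_of_mem_erase hj)]

/-- Replacing one factor of a point mass. -/
theorem sum_prod_update_pi_single [∀ i, DecidableEq (S i)] (s₀ : (i : I) → S i) (i : I)
    (ν : S i → ℝ) (F : ((i : I) → S i) → ℝ) :
    ∑ s : (i : I) → S i,
        (∏ j, Function.update (fun j => Pi.single (M := fun _ => ℝ) (s₀ j) 1) i ν j (s j)) * F s =
      ∑ t, ν t * F (Function.update s₀ i t) := by
  have hprod : ∀ s : (i : I) → S i,
      ∏ j, Function.update (fun j => Pi.single (M := fun _ => ℝ) (s₀ j) 1) i ν j (s j) =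
      ν (s i) * ∏ j ∈ Finset.univ.erase i, Pi.single (M := fun _ => ℝ) (s₀ j) 1 (s j) := by
    intro s
    rw [← Finset.mul_prod_erase _ _ (Finset.mem_univ i), Function.update_self]
    congr 1
    refine Finset.prod_congr rfl fun j hj => ?_
    rw [Function.update_of_ne (Finset.ne_of_mem_erase hj)]
  symm
  refine Finset.sum_of_injOn (fun t => Function.update s₀ i t) ?_ (by simp) ?_ ?_
  · intro t _ t' _ h
    exact Function.update_injective _ _ h
  · intro s _ hs
    rw [hprod]
    -- A profile that is not an update of `s₀` at `i` differs from `s₀` at another player, whose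
    -- point mass then vanishes.
    obtain ⟨j, hj, hne⟩ : ∃ j, j ≠ i ∧ s j ≠ s₀ j := by
      by_contra hcon
      push Not at hcon
      refine hs ⟨s i, by simp, ?_⟩
      ext j
      by_cases hj : j = i
      · subst hj; simp
      · simp [hj, hcon j hj]
    rw [Finset.prod_eq_zero (Finset.mem_erase.2 ⟨hj, Finset.mem_univ j⟩)
      (Pi.single_eq_of_ne hne _)]
    simp
  · intro t _
    rw [hprod, Function.update_self, Finset.prod_eq_one, mul_one]
    intro j hj
    rw [Function.update_of_ne (Finset.ne_of_mem_erase hj), Pi.single_eq_same]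

end Product

namespace ExtensiveGame

variable {I M H : Type w} [Fintype M] [Fintype H] {G : ExtensiveGame I M H} {A : I → Type w}
  {τ : List M → (i : I) → A i}

open Classical in
theorem mixedPayoff_eq [Fintype I] (μ : (i : I) → G.PureStrategy i → ℝ) (i : I) :
    G.mixedPayoff μ i = ∑ s : (i : I) → G.PureStrategy i,
      (∏ i, μ i (s i)) * G.expectFrom G.chance (G.pureBehavior s) [] (fun z => G.payoff z i) :=
  sum_terminals_mixedNodeProb μ _

theorem mixedNodeProb_nonneg [Fintype I] {μ : (i : I) → G.PureStrategy i → ℝ}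
    (hμ : G.IsMixedProfile μ) {z : List M} (hz : z ∈ G.nodes) : 0 ≤ G.mixedNodeProb μ z :=
  Finset.sum_nonneg fun s _ => mul_nonneg (Finset.prod_nonneg fun i _ => (hμ i).1 _)
    (nodeProb_nonneg G.chance_dist (isBehavior_pureBehavior s) hz)

/-- A player who chooses a move for `c` instead of one for `b` whenever he can. -/
theorem IsMechanism.expectFrom_le_deviation [Fintype I] [DecidableEq I] [∀ i, Fintype (A i)]
    [∀ i, DecidableEq (A i)]
    {u : I → ((i : I) → A i) → ℝ} (hG : G.IsMechanism u τ) (α : ((i : I) → A i) → ℝ)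
    {r : List M → Enumeration I} (hr : ∀ z ∈ G.terminals, G.OrderedBy τ z (r z)) (i : I)
    (b c : A i) {s s' : (i : I) → G.PureStrategy i} (hs : ∀ j ≠ i, s' j = s j)
    (hdev : ∀ h : {h // G.owner h = i}, (∃ y ∈ G.nodesOf h.1, G.IsPivotal τ i y ∧
        G.Represents τ i y (s i h) b) →
      ∀ y ∈ G.nodesOf h.1, G.Represents τ i y (s' i h) c)
    (hsame : ∀ h : {h // G.owner h = i}, (¬ ∃ y ∈ G.nodesOf h.1, G.IsPivotal τ i y ∧
        G.Represents τ i y (s i h) b) → s' i h = s i h) :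
    ∀ x ∈ G.nodes, (∀ y m, G.IsPivotal τ i y → G.Represents τ i y m b → ¬ y ++ [m] <+: x) →
      G.expectFrom G.chance (G.pureBehavior s) x (fun z =>
          if τ z i = b then worstPayoff u α (fun _ => Set.univ) (r z) (τ z) i c else u i (τ z)) ≤
        G.expectFrom G.chance (G.pureBehavior s') x (fun z => u i (τ z)) := by
  classical
  have hB := isBehavior_pureBehavior (G := G) s
  have hB' := isBehavior_pureBehavior (G := G) s'
  -- The invariant is that no pivotal move for `b` lies above `x`. At a terminal node it excludes
  -- the outcome `b`, so the two integrands agree there.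
  refine G.backward_induction fun x hx ih hpre => ?_
  rcases (G.moves x).eq_empty_or_nonempty with hem | hne
  · have hxt := G.mem_terminals.2 ⟨hx, hem⟩
    rw [GameTree.expectFrom_of_terminal _ _ _ hxt, GameTree.expectFrom_of_terminal _ _ _ hxt,
      if_neg]
    rintro rfl
    obtain ⟨y, m, hp, hrep, hz⟩ := hG.2.2 x hxt i
    exact hpre y m hp hrep (G.mem_terminalsAfter.1 hz).2
  rw [GameTree.expectFrom_step _ _ _ hne, GameTree.expectFrom_step _ _ _ hne]
  -- A move that does not settle `b` at a pivotal node keeps the invariant; if it is also equally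
  -- likely under both profiles, the induction hypothesis can be used after it.
  have hchild : ∀ m ∈ G.moves x, ¬ (G.IsPivotal τ i x ∧ G.Represents τ i x m b) →
      G.stepProb G.chance (G.pureBehavior s) x m = G.stepProb G.chance (G.pureBehavior s') x m →
      G.stepProb G.chance (G.pureBehavior s) x m *
        G.expectFrom G.chance (G.pureBehavior s) (x ++ [m]) (fun z => if τ z i = b then
          worstPayoff u α (fun _ => Set.univ) (r z) (τ z) i c else u i (τ z)) ≤
      G.stepProb G.chance (G.pureBehavior s') x m *
        G.expectFrom G.chance (G.pureBehavior s') (x ++ [m]) (fun z => u i (τ z)) := by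
    intro m hm hnot heq
    rw [← heq]
    refine mul_le_mul_of_nonneg_left (ih m hm fun y m' hp hrep hpr => ?_)
      (stepProb_nonneg G.chance_dist hB hx hm)
    rcases List.prefix_concat_iff.1 hpr with h | h
    · obtain ⟨rfl, h2⟩ := List.append_inj' h rfl
      simp only [List.cons.injEq, and_true] at h2
      subst h2
      exact hnot ⟨hp, hrep⟩
    · exact hpre y m' hp hrep h
  rcases hinf : G.infoSet x with _ | h
  · refine Finset.sum_le_sum fun m hm => hchild m hm ?_ ?_
    · rintro ⟨⟨⟨h, _, hy⟩, _⟩, _⟩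
      have := (G.mem_nodesOf.1 hy).2.2
      simp [hinf] at this
    · simp only [GameTree.stepProb, hinf]
  by_cases hown : G.owner h = i
  swap
  · refine Finset.sum_le_sum fun m hm => hchild m hm ?_ ?_
    · rintro ⟨⟨hd, _⟩, _⟩
      exact hown (hd.owner_eq hinf)
    · simp only [GameTree.stepProb, hinf, pureBehavior, hs _ hown]
  subst hown
  have hxh := G.mem_nodesOf.2 ⟨hx, hne, hinf⟩
  have hmoves := G.movesAt_eq hxh
  have hstep : ∀ (t : (i : I) → G.PureStrategy i) (f : List M → ℝ),
      ∑ m ∈ G.moves x, G.stepProb G.chance (G.pureBehavior t) x m *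
        G.expectFrom G.chance (G.pureBehavior t) (x ++ [m]) f =
      G.expectFrom G.chance (G.pureBehavior t) (x ++ [(t (G.owner h) ⟨h, rfl⟩ : M)]) f := by
    intro t f
    simp only [GameTree.stepProb, hinf, pureBehavior, ite_mul, one_mul, zero_mul]
    rw [Finset.sum_ite_eq, if_pos]
    rw [← hmoves]
    exact (t (G.owner h) ⟨h, rfl⟩).2
  -- This is where the profiles part. Every payoff after the move for `c` is at least every worst
  -- payoff attached to plays after the move for `b`, so later behavior is irrelevant and no
  -- induction is needed.
  by_cases hcase : G.IsPivotal τ (G.owner h) x ∧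
      G.Represents τ (G.owner h) x (s (G.owner h) ⟨h, rfl⟩) b
  · rw [hstep, hstep]
    have hrep' := hdev ⟨h, rfl⟩ ⟨x, hxh, hcase⟩ x hxh
    refine expectFrom_le_expectFrom G.chance_dist hB G.chance_dist hB'
      (G.mem_moves.1 hcase.2.1) (G.mem_moves.1 hrep'.1) fun z hz z' hz' => ?_
    rw [if_pos (hcase.2.2.1 z hz)]
    exact (hr z (G.mem_terminalsAfter.1 hz).1).worstPayoff_le u α hcase.2 hz hrep' hz'
  · have hsame' : s' (G.owner h) ⟨h, rfl⟩ = s (G.owner h) ⟨h, rfl⟩ := by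
      refine hsame ⟨h, rfl⟩ ?_
      rintro ⟨y, hy, hp, hrep⟩
      exact hcase ⟨hG.2.1.isPivotal hy hxh hp, (hG.2.1 h y hy x hxh _ _).1 hrep⟩
    refine Finset.sum_le_sum fun m hm => ?_
    have heq : G.stepProb G.chance (G.pureBehavior s) x m =
        G.stepProb G.chance (G.pureBehavior s') x m := by
      simp only [GameTree.stepProb, hinf, pureBehavior, hsame']
    by_cases hm' : (s (G.owner h) ⟨h, rfl⟩ : M) = m
    · subst hm'
      exact hchild _ hm hcase heq
    · have h0 : G.stepProb G.chance (G.pureBehavior s) x m = 0 := by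
        simp only [GameTree.stepProb, hinf, pureBehavior, if_neg hm']
      rw [← heq, h0]; simp

end ExtensiveGame

open ExtensiveGame

theorem NashImplementable.isICE {I : Type w} [Fintype I] [DecidableEq I] {A : I → Type w}
    [∀ i, Fintype (A i)] [∀ i, DecidableEq (A i)] {u : I → ((i : I) → A i) → ℝ}
    {α : ((i : I) → A i) → ℝ} (hα : α ∈ stdSimplex ℝ ((i : I) → A i))
    (h : NashImplementable u α) : IsICE u α := by
  -- `IsNash` updates profiles with the classical instance; identifying the two instances lets
  -- `Function.update` match.
  obtain rfl : ‹DecidableEq I› = fun _ _ => Classical.propDecidable _ := Subsingleton.elim _ _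
  classical
  obtain ⟨M, H, _, _, G, τ, hG, μ, ⟨hμ, hnash⟩, hout⟩ := h
  let r : List M → Enumeration I := fun z =>
    open Classical in
    if hz : z ∈ G.terminals then (exists_orderedBy hG hz).choose else Fintype.equivFin I
  have hr : ∀ z ∈ G.terminals, G.OrderedBy τ z (r z) := fun z hz => by
    simp only [r, hz, dif_pos]
    exact (exists_orderedBy hG hz).choose_spec
  refine isICE_of_plays u G.terminals (G.mixedNodeProb μ)
    (fun z hz => mixedNodeProb_nonneg hμ (G.mem_terminals.1 hz).1) τ r hα
    (fun a => by rw [hout a]; congr) fun i b c => ?_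
  choose dev hdev using fun h => hG.2.1.exists_deviation i c h
  have hdev' : ∀ (h : {h // G.owner h = i}) (m : M), (∃ y ∈ G.nodesOf h.1, G.IsPivotal τ i y ∧
      G.Represents τ i y m b) → ∀ y ∈ G.nodesOf h.1, G.Represents τ i y (dev h.1) c := by
    rintro ⟨h, rfl⟩ m ⟨y, hy, hp, _⟩ y' hy'
    exact hdev h ⟨y, hy, hp⟩ y' hy' (hG.2.1.isPivotal hy hy' hp)
  -- Every pure strategy is altered only where it would settle `b` at a pivotal node. Applying this
  -- to the strategy drawn from `μ i` gives the mixed deviation `ν`.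
  let D : G.PureStrategy i → G.PureStrategy i := fun t h =>
    if hh : ∃ y ∈ G.nodesOf h.1, G.IsPivotal τ i y ∧ G.Represents τ i y (t h) b then
      ⟨dev h.1, G.mem_movesAt.2 ⟨hh.choose, hh.choose_spec.1,
        (hdev' h _ hh _ hh.choose_spec.1).1⟩⟩ else t h
  let ν : G.PureStrategy i → ℝ := fun t => ∑ t' with D t' = t, μ i t'
  have hν : ν ∈ stdSimplex ℝ (G.PureStrategy i) := by
    refine ⟨fun t => Finset.sum_nonneg fun t' _ => (hμ i).1 t', ?_⟩
    rw [← (hμ i).2, ← Finset.sum_fiberwise Finset.univ D (μ i)]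
  have h1 : G.mixedPayoff (Function.update μ i ν) i =
      ∑ s : (i : I) → G.PureStrategy i, (∏ i, μ i (s i)) *
        G.expectFrom G.chance (G.pureBehavior (Function.update s i (D (s i)))) []
          (fun z => G.payoff z i) := by
    rw [mixedPayoff_eq]
    convert sum_prod_update_map μ i D (fun s => G.expectFrom G.chance (G.pureBehavior s) []
          (fun z => G.payoff z i)) using 6
  have h2 : ∑ z ∈ G.terminals, G.mixedNodeProb μ z * (if τ z i = b then
        worstPayoff u α (fun _ => Set.univ) (r z) (τ z) i c else u i (τ z)) ≤
      G.mixedPayoff (Function.update μ i ν) i := by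
    rw [h1, sum_terminals_mixedNodeProb]
    have hpay : ∀ s : (i : I) → G.PureStrategy i,
        G.expectFrom G.chance (G.pureBehavior s) [] (fun z => G.payoff z i) =
        G.expectFrom G.chance (G.pureBehavior s) [] (fun z => u i (τ z)) := fun s =>
      Finset.sum_congr rfl fun z hz => by
        dsimp only
        rw [hG.1.2 z (G.mem_terminalsAfter.1 hz).1]
    simp only [hpay]
    refine Finset.sum_le_sum fun s _ => mul_le_mul_of_nonneg_left
      (hG.expectFrom_le_deviation α hr i b c (s := s) (s' := Function.update s i (D (s i)))
      (fun j hj => Function.update_of_ne hj _ _) ?_ ?_ [] G.root_mem (by simp))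
      (Finset.prod_nonneg fun i _ => (hμ i).1 (s i))
    · intro h hh y hy
      simp only [Function.update_self, D, dif_pos hh]
      exact hdev' h _ hh y hy
    · intro h hh
      simp only [Function.update_self, D, dif_neg hh]
  have h3 := h2.trans (hnash i ν hν)
  -- Plays in which `i` does not end with `b` cancel, which leaves exactly the ICE sum for `b` and
  -- `c`.
  rw [← sub_nonneg, mixedPayoff, ← Finset.sum_sub_distrib] at h3
  rw [Finset.sum_filter]
  refine h3.trans_eq (Finset.sum_congr rfl fun z hz => ?_)
  rw [hG.1.2 z hz]
  split <;> ring

end ChoiceInterdependence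

/-! ### The extensive form of a mediated game -/

namespace ChoiceInterdependence

/-- A mediator visits the players one after the other. The order `ord ω` depends on a state `ω`
chosen by Nature. Player `i` receives a message, which depends on the state and on the actions of
the players visited before, and then chooses an action. -/
structure Mediator {I : Type w} [Fintype I] (Ω : Type w) (K A : I → Type w) where
  ord : Ω → Enumeration I
  msg : Ω → (i : I) → ((i : I) → A i) → K i
  msg_congr : ∀ ω i (a a' : (i : I) → A i), (∀ j, ord ω j < ord ω i → a j = a' j) →
    msg ω i a = msg ω i a'
  msg_surjective : ∀ i κ, ∃ ω a, msg ω i a = κ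
  chance : Ω → ℝ

namespace Mediator

variable {I : Type w} [Fintype I] {Ω : Type w} {K A : I → Type w} (D : Mediator Ω K A)

/-- Moves in the game of a mediator: states for Nature and actions for the players. -/
abbrev Move (Ω : Type w) (A : I → Type w) : Type w := Ω ⊕ (Σ i, A i)

/-- The moves of the players in the order of the state `ω`, if they choose the profile `a`. -/
def actions (ω : Ω) (a : (i : I) → A i) : List (Move Ω A) :=
  List.ofFn fun t => Sum.inr ⟨(D.ord ω).symm t, a ((D.ord ω).symm t)⟩

/-- The node at which `k` players have been visited. -/
def node (ω : Ω) (a : (i : I) → A i) (k : ℕ) : List (Move Ω A) :=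
  Sum.inl ω :: (D.actions ω a).take k

variable {D}

theorem node_ne_nil {ω : Ω} {a : (i : I) → A i} {k : ℕ} : D.node ω a k ≠ [] := by simp [node]

theorem length_actions (ω : Ω) (a : (i : I) → A i) :
    (D.actions ω a).length = Fintype.card I := by simp [actions]

theorem length_node {ω : Ω} {a : (i : I) → A i} {k : ℕ} (hk : k ≤ Fintype.card I) :
    (D.node ω a k).length = k + 1 := by
  simp [node, length_actions, hk]

theorem node_zero (ω : Ω) (a : (i : I) → A i) : D.node ω a 0 = [Sum.inl ω] := by simp [node]

theorem node_ord_succ (ω : Ω) (a : (i : I) → A i) (i : I) :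
    D.node ω a (D.ord ω i + 1) = D.node ω a (D.ord ω i) ++ [Sum.inr ⟨i, a i⟩] := by
  have h : (D.ord ω i : ℕ) < (D.actions ω a).length := by
    rw [length_actions]; exact (D.ord ω i).2
  rw [node, node, List.take_succ_eq_append_getElem h]
  simp only [actions, List.getElem_ofFn, Fin.eta, List.cons_append, List.cons.injEq, true_and,
    List.append_cancel_left_eq, and_true, Sum.inr.injEq, Sigma.mk.injEq,
    Equiv.symm_apply_apply]
  rw [Equiv.symm_apply_apply]

theorem exists_ord_eq (D : Mediator Ω K A) (ω : Ω) {k : ℕ} (hk : k < Fintype.card I) :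
    ∃ i, (D.ord ω i : ℕ) = k :=
  ⟨(D.ord ω).symm ⟨k, hk⟩, by simp⟩

theorem node_congr {ω : Ω} {a a' : (i : I) → A i} {k : ℕ}
    (h : ∀ j, (D.ord ω j : ℕ) < k → a j = a' j) : D.node ω a k = D.node ω a' k := by
  rw [node, node]
  congr 1
  refine List.ext_getElem (by simp [length_actions]) fun t h1 _ => ?_
  have ht : t < k := by simp at h1; omega
  have h2 : t < Fintype.card I := by simp [length_actions] at h1; omega
  simp only [List.getElem_take, actions, List.getElem_ofFn]
  rw [h ((D.ord ω).symm ⟨t, h2⟩) (by simpa using ht)]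

/-- A node remembers the state, the number of visits and the actions of those already visited, and
nothing of the rest of the profile. -/
theorem node_inj {ω ω' : Ω} {a a' : (i : I) → A i} {k k' : ℕ} (hk : k ≤ Fintype.card I)
    (hk' : k' ≤ Fintype.card I) (h : D.node ω a k = D.node ω' a' k') :
    ω = ω' ∧ k = k' ∧ ∀ j, (D.ord ω j : ℕ) < k → a j = a' j := by
  have hl := congrArg List.length h
  rw [length_node hk, length_node hk'] at hl
  obtain rfl : k = k' := by omega
  rw [node, node, List.cons.injEq, Sum.inl.injEq] at h
  obtain ⟨rfl, h⟩ := h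
  refine ⟨rfl, rfl, fun j hj => ?_⟩
  have h1 : ((D.actions ω a).take k)[(D.ord ω j : ℕ)]? =
      ((D.actions ω a').take k)[(D.ord ω j : ℕ)]? := by rw [h]
  have h2 : (D.ord ω j : ℕ) < Fintype.card I := (D.ord ω j).2
  simp only [List.getElem?_take, hj, if_true, actions, List.getElem?_ofFn, h2, dif_pos,
    Option.some_inj, Sum.inr.injEq, Fin.eta, Equiv.symm_apply_apply, Sigma.mk.injEq, true_and] at h1
  rw [Equiv.symm_apply_apply] at h1
  exact eq_of_heq h1

theorem ord_inj {ω : Ω} {i j : I} (h : (D.ord ω i : ℕ) = D.ord ω j) : i = j :=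
  (D.ord ω).injective (Fin.ext h)

theorem ord_le {ω : Ω} {i : I} : (D.ord ω i : ℕ) ≤ Fintype.card I := (D.ord ω i).2.le

theorem node_append [DecidableEq I] (ω : Ω) (a : (i : I) → A i) (i : I) (c : A i) :
    D.node ω a (D.ord ω i) ++ [Sum.inr ⟨i, c⟩] =
      D.node ω (Function.update a i c) (D.ord ω i + 1) := by
  rw [node_ord_succ, Function.update_self]
  congr 1
  refine node_congr fun j hj => ?_
  rw [Function.update_of_ne]
  rintro rfl
  exact lt_irrefl _ hj

theorem dropLast_node {ω : Ω} {a : (i : I) → A i} {k : ℕ} (hk : k < Fintype.card I) :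
    (D.node ω a (k + 1)).dropLast = D.node ω a k := by
  obtain ⟨i, rfl⟩ := D.exists_ord_eq ω hk
  rw [node_ord_succ, List.dropLast_concat]

variable (D) in
/-- The information set of a node: the player who is visited, and his message. -/
noncomputable def infoSet (x : List (Move Ω A)) : Option (Σ i, K i) :=
  open Classical in
  if h : ∃ q : Ω × ((i : I) → A i) × I, x = D.node q.1 q.2.1 (D.ord q.1 q.2.2) then
    some ⟨h.choose.2.2, D.msg h.choose.1 h.choose.2.2 h.choose.2.1⟩ else none

theorem infoSet_nil : D.infoSet [] = none := by
  rw [infoSet, dif_neg]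
  rintro ⟨q, hq⟩
  exact node_ne_nil hq.symm

/-- The chosen representation of the node may have another profile, but only off the players visited
before `i`, on whom alone the message depends. -/
theorem infoSet_node (ω : Ω) (a : (i : I) → A i) (i : I) :
    D.infoSet (D.node ω a (D.ord ω i)) = some ⟨i, D.msg ω i a⟩ := by
  have h : ∃ q : Ω × ((i : I) → A i) × I,
    D.node ω a (D.ord ω i) = D.node q.1 q.2.1 (D.ord q.1 q.2.2) := ⟨(ω, a, i), rfl⟩
  rw [infoSet, dif_pos h]
  obtain ⟨h1, h2, h3⟩ := node_inj ord_le ord_le h.choose_spec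
  generalize h.choose = q at h1 h2 h3
  obtain ⟨ω', a', i'⟩ := q
  obtain rfl : ω = ω' := h1
  obtain rfl : i = i' := ord_inj h2
  rw [D.msg_congr ω i a' a fun j hj => (h3 j hj).symm]

variable (D) in
/-- The action profile at a terminal node. -/
noncomputable def outcome [∀ i, Nonempty (A i)] (x : List (Move Ω A)) : (i : I) → A i :=
  open Classical in
  if h : ∃ q : Ω × ((i : I) → A i), x = D.node q.1 q.2 (Fintype.card I) then h.choose.2
  else Classical.arbitrary _

theorem outcome_node [∀ i, Nonempty (A i)] (ω : Ω) (a : (i : I) → A i) :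
    D.outcome (D.node ω a (Fintype.card I)) = a := by
  have h : ∃ q : Ω × ((i : I) → A i),
    D.node ω a (Fintype.card I) = D.node q.1 q.2 (Fintype.card I) := ⟨(ω, a), rfl⟩
  rw [outcome, dif_pos h]
  obtain ⟨h1, -, h3⟩ := node_inj le_rfl le_rfl h.choose_spec
  funext j
  exact (h3 j (D.ord ω j).2).symm

variable [Fintype Ω] [∀ i, Fintype (A i)] [∀ i, Fintype (K i)]

open Classical in
variable (D) in
/-- The game tree of a mediator. -/
noncomputable def tree : GameTree I (Move Ω A) (Σ i, K i) where
  nodes := insert [] (Finset.univ.image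
    fun q : Ω × ((i : I) → A i) × Fin (Fintype.card I + 1) => D.node q.1 q.2.1 q.2.2)
  root_mem := Finset.mem_insert_self _ _
  prefix_mem x m hx := by
    simp only [Finset.mem_insert, List.append_eq_nil_iff, List.cons_ne_self, and_false,
      Finset.mem_image, Finset.mem_univ, true_and, Prod.exists, false_or] at hx
    obtain ⟨ω, a, ⟨k, hk⟩, h⟩ := hx
    have h' := congrArg List.dropLast h
    rw [List.dropLast_concat] at h'
    rcases k with _ | k
    · simp only [node_zero, List.dropLast_singleton] at h'
      rw [← h']
      exact Finset.mem_insert_self _ _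
    · rw [dropLast_node (by omega)] at h'
      refine Finset.mem_insert_of_mem (Finset.mem_image.2
        ⟨(ω, a, ⟨k, by omega⟩), Finset.mem_univ _, h'⟩)
  infoSet := D.infoSet
  owner := Sigma.fst

theorem mem_nodes {x : List (Move Ω A)} :
    x ∈ D.tree.nodes ↔ x = [] ∨ ∃ ω a k, k ≤ Fintype.card I ∧ x = D.node ω a k := by
  simp only [tree, Finset.mem_insert, Finset.mem_image, Finset.mem_univ, true_and, Prod.exists]
  refine or_congr_right ⟨?_, ?_⟩
  · rintro ⟨ω, a, ⟨k, hk⟩, rfl⟩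
    exact ⟨ω, a, k, by omega, rfl⟩
  · rintro ⟨ω, a, k, hk, rfl⟩
    exact ⟨ω, a, ⟨k, by omega⟩, rfl⟩

theorem node_mem {ω : Ω} {a : (i : I) → A i} {k : ℕ} (hk : k ≤ Fintype.card I) :
    D.node ω a k ∈ D.tree.nodes :=
  mem_nodes.2 (Or.inr ⟨ω, a, k, hk, rfl⟩)

theorem mem_moves_nil [∀ i, Nonempty (A i)] {m : Move Ω A} :
    m ∈ D.tree.moves [] ↔ ∃ ω, m = Sum.inl ω := by
  rw [GameTree.mem_moves, List.nil_append]
  constructor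
  · intro h
    rcases mem_nodes.1 h with h | ⟨ω, a, k, _, h⟩
    · simp at h
    · rw [node, List.cons.injEq] at h
      exact ⟨ω, h.1⟩
  · rintro ⟨ω, rfl⟩
    rw [← node_zero (D := D) ω (Classical.arbitrary _)]
    exact node_mem (Nat.zero_le _)

theorem mem_moves_node {ω : Ω} {a : (i : I) → A i} {i : I} {m : Move Ω A} :
    m ∈ D.tree.moves (D.node ω a (D.ord ω i)) ↔ ∃ c, m = Sum.inr ⟨i, c⟩ := by
  classical
  rw [GameTree.mem_moves]
  constructor
  · intro h
    rcases mem_nodes.1 h with h | ⟨ω', a', k, hk, h⟩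
    · simp at h
    · have hl := congrArg List.length h
      rw [List.length_append, length_node ord_le, length_node hk] at hl
      simp only [List.length_cons, List.length_nil] at hl
      obtain rfl : k = D.ord ω i + 1 := by omega
      have h' := congrArg List.dropLast h
      rw [List.dropLast_concat, dropLast_node (by omega)] at h'
      obtain ⟨rfl, -, -⟩ := node_inj ord_le (by omega) h'
      rw [node_ord_succ] at h
      exact ⟨a' i, by simpa using (List.append_inj' h rfl).2⟩
  · rintro ⟨c, rfl⟩
    rw [node_append]
    exact node_mem (D.ord ω i).2

theorem moves_node_card {ω : Ω} {a : (i : I) → A i} :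
    D.tree.moves (D.node ω a (Fintype.card I)) = ∅ := by
  rw [Finset.eq_empty_iff_forall_notMem]
  intro m hm
  rcases mem_nodes.1 (D.tree.mem_moves.1 hm) with h | ⟨ω', a', k, hk, h⟩
  · simp at h
  · have hl := congrArg List.length h
    rw [List.length_append, length_node le_rfl, length_node hk] at hl
    simp only [List.length_cons, List.length_nil] at hl
    omega

variable [∀ i, Nonempty (A i)]

theorem moves_node_nonempty {ω : Ω} {a : (i : I) → A i} {i : I} :
    (D.tree.moves (D.node ω a (D.ord ω i))).Nonempty :=
  ⟨_, mem_moves_node.2 ⟨Classical.arbitrary _, rfl⟩⟩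

theorem mem_terminals [Nonempty Ω] {z : List (Move Ω A)} :
    z ∈ D.tree.terminals ↔ ∃ ω a, z = D.node ω a (Fintype.card I) := by
  rw [GameTree.mem_terminals]
  constructor
  · rintro ⟨hz, hm⟩
    rcases mem_nodes.1 hz with rfl | ⟨ω, a, k, hk, rfl⟩
    · have : Sum.inl (Classical.arbitrary Ω) ∈ D.tree.moves [] := mem_moves_nil.2 ⟨_, rfl⟩
      rw [hm] at this
      simp at this
    · rcases hk.eq_or_lt with rfl | hk
      · exact ⟨ω, a, rfl⟩
      · obtain ⟨i, rfl⟩ := D.exists_ord_eq ω hk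
        exact absurd hm moves_node_nonempty.ne_empty
  · rintro ⟨ω, a, rfl⟩
    exact ⟨node_mem le_rfl, moves_node_card⟩

theorem mem_nodesOf {i : I} {κ : K i} {x : List (Move Ω A)} :
    x ∈ D.tree.nodesOf ⟨i, κ⟩ ↔ ∃ ω a, D.msg ω i a = κ ∧ x = D.node ω a (D.ord ω i) := by
  rw [GameTree.mem_nodesOf]
  constructor
  · rintro ⟨hx, hm, hi⟩
    change D.infoSet x = _ at hi
    rcases mem_nodes.1 hx with rfl | ⟨ω, a, k, hk, rfl⟩
    · rw [infoSet_nil] at hi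
      simp at hi
    · rcases hk.eq_or_lt with rfl | hk
      · rw [moves_node_card] at hm
        simp at hm
      · obtain ⟨j, rfl⟩ := D.exists_ord_eq ω hk
        rw [infoSet_node, Option.some_inj] at hi
        obtain rfl : j = i := congrArg Sigma.fst hi
        exact ⟨ω, a, eq_of_heq (Sigma.mk.inj hi).2, rfl⟩
  · rintro ⟨ω, a, rfl, rfl⟩
    exact ⟨node_mem ord_le, moves_node_nonempty, infoSet_node ω a i⟩

theorem mem_natureNodes [Nonempty Ω] {x : List (Move Ω A)} : x ∈ D.tree.natureNodes ↔ x = [] := by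
  rw [GameTree.mem_natureNodes]
  constructor
  · rintro ⟨hx, hm, hi⟩
    change D.infoSet x = _ at hi
    rcases mem_nodes.1 hx with rfl | ⟨ω, a, k, hk, rfl⟩
    · rfl
    · rcases hk.eq_or_lt with rfl | hk
      · rw [moves_node_card] at hm
        simp at hm
      · obtain ⟨j, rfl⟩ := D.exists_ord_eq ω hk
        rw [infoSet_node] at hi
        simp at hi
  · rintro rfl
    exact ⟨D.tree.root_mem, ⟨Sum.inl (Classical.arbitrary Ω), mem_moves_nil.2 ⟨_, rfl⟩⟩,
      infoSet_nil⟩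

theorem mem_movesAt {i : I} {κ : K i} {m : Move Ω A} :
    m ∈ D.tree.movesAt ⟨i, κ⟩ ↔ ∃ c, m = Sum.inr ⟨i, c⟩ := by
  rw [GameTree.mem_movesAt]
  constructor
  · rintro ⟨x, hx, hm⟩
    obtain ⟨ω, a, -, rfl⟩ := mem_nodesOf.1 hx
    exact mem_moves_node.1 hm
  · rintro ⟨c, rfl⟩
    obtain ⟨ω, a, h⟩ := D.msg_surjective i κ
    exact ⟨_, mem_nodesOf.2 ⟨ω, a, h, rfl⟩, mem_moves_node.2 ⟨c, rfl⟩⟩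

theorem sum_moves_nil (F : Move Ω A → ℝ) :
    ∑ m ∈ D.tree.moves [], F m = ∑ ω, F (Sum.inl ω) := by
  symm
  refine Finset.sum_bij (fun ω _ => Sum.inl ω) (fun ω _ => mem_moves_nil.2 ⟨ω, rfl⟩)
    (fun _ _ _ _ h => Sum.inl_injective h) (fun m hm => ?_) fun _ _ => rfl
  obtain ⟨ω, rfl⟩ := mem_moves_nil.1 hm
  exact ⟨ω, Finset.mem_univ _, rfl⟩

theorem sum_movesAt {i : I} {κ : K i} (F : Move Ω A → ℝ) :
    ∑ m ∈ D.tree.movesAt ⟨i, κ⟩, F m = ∑ c, F (Sum.inr ⟨i, c⟩) := by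
  symm
  refine Finset.sum_bij (fun c _ => Sum.inr ⟨i, c⟩) (fun c _ => mem_movesAt.2 ⟨c, rfl⟩)
    (fun _ _ _ _ h => by simpa using h) (fun m hm => ?_) fun _ _ => rfl
  obtain ⟨c, rfl⟩ := mem_movesAt.1 hm
  exact ⟨c, Finset.mem_univ _, rfl⟩

theorem moves_node_eq {ω : Ω} {a : (i : I) → A i} {i : I} :
    D.tree.moves (D.node ω a (D.ord ω i)) = D.tree.movesAt ⟨i, D.msg ω i a⟩ := by
  ext m
  rw [mem_moves_node, mem_movesAt]

theorem experienceFrom_eq_nil {M H : Type w} (G : GameTree I M H) (i : I) (x l : List M)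
    (h : ∀ l', l' <+: l → l' ≠ l → ∀ h, G.infoSet (x ++ l') = some h → G.owner h ≠ i) :
    G.experienceFrom i x l = [] := by
  induction l generalizing x with
  | nil => rfl
  | cons m l ih =>
    rw [GameTree.experienceFrom, ih]
    · rw [List.append_nil]
      split
      · rfl
      · rename_i h' hh
        rw [if_neg (h [] (List.nil_prefix) (by simp) h' (by simpa using hh))]
    · intro l' hl' hne h' hh
      exact h (m :: l') (by simpa using hl') (by simpa using hne) h' (by simpa using hh)

theorem prefix_node {ω : Ω} {a : (i : I) → A i} {k : ℕ} {x : List (Move Ω A)}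
    (h : x <+: D.node ω a k) : x = [] ∨ ∃ k' ≤ k, x = D.node ω a k' := by
  rw [node, List.prefix_cons_iff] at h
  rcases h with rfl | ⟨t, rfl, ht⟩
  · exact Or.inl rfl
  · rw [List.prefix_take_iff] at ht
    refine Or.inr ⟨t.length, ht.2, ?_⟩
    rw [node, ← List.prefix_iff_eq_take.1 ht.1]

/-- Each player is visited once, so he has no experience when he moves, and perfect recall holds
trivially. -/
theorem experience_node (ω : Ω) (a : (i : I) → A i) (i : I) :
    D.tree.experience i (D.node ω a (D.ord ω i)) = [] := by
  refine experienceFrom_eq_nil _ _ _ _ fun x hx hne h hh => ?_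
  rw [List.nil_append] at hh
  change D.infoSet x = _ at hh
  rcases prefix_node hx with rfl | ⟨k, hk, rfl⟩
  · rw [infoSet_nil] at hh
    simp at hh
  · have hk' : k < D.ord ω i := lt_of_le_of_ne hk fun hk => hne (by rw [hk])
    obtain ⟨j, rfl⟩ := D.exists_ord_eq ω (hk'.trans (D.ord ω i).2)
    rw [infoSet_node, Option.some_inj] at hh
    subst hh
    change j ≠ i
    rintro rfl
    exact lt_irrefl _ hk'

/-- The behavior of Nature given by weights on the states. -/
def chanceBehavior (p : Ω → ℝ) (_ : List (Move Ω A)) : Move Ω A → ℝ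
  | Sum.inl ω => p ω
  | Sum.inr _ => 0

/-- The behavior of the players given by their responses to messages. -/
noncomputable def behavior (q : (i : I) → K i → A i → ℝ) (h : Σ i, K i) : Move Ω A → ℝ
  | Sum.inl _ => 0
  | Sum.inr b => open Classical in if e : b.1 = h.1 then q h.1 h.2 (e ▸ b.2) else 0

theorem behavior_inr (q : (i : I) → K i → A i → ℝ) (i : I) (κ : K i) (c : A i) :
    behavior (Ω := Ω) q ⟨i, κ⟩ (Sum.inr ⟨i, c⟩) = q i κ c := by
  simp [behavior]

theorem isNatureBehavior [Nonempty Ω] {p : Ω → ℝ} (hp : p ∈ stdSimplex ℝ Ω) :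
    D.tree.IsNatureBehavior (chanceBehavior p) := by
  intro x hx
  obtain rfl := mem_natureNodes.1 hx
  refine ⟨fun m hm => ?_, ?_⟩
  · obtain ⟨ω, rfl⟩ := mem_moves_nil.1 hm
    exact hp.1 ω
  · rw [sum_moves_nil]
    exact hp.2

theorem isBehavior {q : (i : I) → K i → A i → ℝ} (hq : ∀ i κ, q i κ ∈ stdSimplex ℝ (A i)) :
    D.tree.IsBehavior (behavior q) := by
  rintro ⟨i, κ⟩
  refine ⟨fun m hm => ?_, ?_⟩
  · obtain ⟨c, rfl⟩ := mem_movesAt.1 hm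
    rw [behavior_inr]
    exact (hq i κ).1 c
  · rw [sum_movesAt, ← (hq i κ).2]
    exact Finset.sum_congr rfl fun c _ => behavior_inr q i κ c

/-- Along a path the state is drawn once and each visited player contributes one factor, his
response to the message that the profile itself generates. -/
theorem nodeProb_node (p : Ω → ℝ) (q : (i : I) → K i → A i → ℝ) (ω : Ω) (a : (i : I) → A i)
    {k : ℕ} (hk : k ≤ Fintype.card I) :
    D.tree.nodeProb (chanceBehavior p) (behavior q) (D.node ω a k) =
      p ω * ∏ j with (D.ord ω j : ℕ) < k, q j (D.msg ω j a) (a j) := by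
  classical
  induction k with
  | zero =>
    have h : D.tree.infoSet [] = none := infoSet_nil
    simp [node_zero, GameTree.nodeProb, GameTree.pathProb, GameTree.stepProb, h, chanceBehavior]
  | succ k ih =>
    obtain ⟨i, rfl⟩ := D.exists_ord_eq ω hk
    have h : D.tree.infoSet (D.node ω a (D.ord ω i)) = some ⟨i, D.msg ω i a⟩ := infoSet_node ω a i
    rw [node_ord_succ, GameTree.nodeProb_append_singleton, ih ord_le, GameTree.stepProb]
    simp only [h, behavior_inr]
    have hset : (Finset.univ.filter fun j => (D.ord ω j : ℕ) < D.ord ω i + 1) =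
        insert i (Finset.univ.filter fun j => (D.ord ω j : ℕ) < D.ord ω i) := by
      ext j
      simp only [Finset.mem_filter, Finset.mem_univ, true_and, Finset.mem_insert]
      constructor
      · intro hj
        rcases (Nat.lt_succ_iff.1 hj).eq_or_lt with h | h
        · exact Or.inl (ord_inj h)
        · exact Or.inr h
      · rintro (rfl | hj) <;> omega
    rw [hset, Finset.prod_insert (by simp)]
    ring

variable (D) in
/-- The game in which a mediator visits the players. -/
noncomputable def game (u : I → ((i : I) → A i) → ℝ) (hD : D.chance ∈ stdSimplex ℝ Ω) :
    ExtensiveGame I (Move Ω A) (Σ i, K i) where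
  toGameTree := D.tree
  info_nonempty := by
    rintro ⟨i, κ⟩
    obtain ⟨ω, a, h⟩ := D.msg_surjective i κ
    exact ⟨_, mem_nodesOf.2 ⟨ω, a, h, rfl⟩⟩
  info_moves := by
    rintro ⟨i, κ⟩ x hx y hy
    obtain ⟨ω, a, rfl, rfl⟩ := mem_nodesOf.1 hx
    obtain ⟨ω', a', h, rfl⟩ := mem_nodesOf.1 hy
    rw [moves_node_eq, moves_node_eq, h]
  perfect_recall := by
    rintro ⟨i, κ⟩ x hx y hy
    obtain ⟨ω, a, rfl, rfl⟩ := mem_nodesOf.1 hx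
    obtain ⟨ω', a', h, rfl⟩ := mem_nodesOf.1 hy
    exact (experience_node ω a i).trans (experience_node ω' a' i).symm
  chance := chanceBehavior D.chance
  chance_dist := by
    have : Nonempty Ω := by
      by_contra h
      rw [not_nonempty_iff] at h
      simpa using hD.2
    exact isNatureBehavior hD
  payoff z i := u i (D.outcome z)

end Mediator
end ChoiceInterdependence

/-! ### Equilibrium criteria for mediated games -/

namespace ChoiceInterdependence

theorem sum_prod_pi_single {I : Type*} [Fintype I] [DecidableEq I] {S : I → Type*}
    [∀ i, Fintype (S i)] [∀ i, DecidableEq (S i)] (s₀ : (i : I) → S i)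
    (F : ((i : I) → S i) → ℝ) :
    ∑ s : (i : I) → S i, (∏ j, Pi.single (M := fun _ => ℝ) (s₀ j) 1 (s j)) * F s = F s₀ := by
  rw [Finset.sum_eq_single s₀]
  · simp
  · intro s _ hs
    obtain ⟨j, hj⟩ := Function.ne_iff.1 hs
    rw [Finset.prod_eq_zero (Finset.mem_univ j) (Pi.single_eq_of_ne hj _), zero_mul]
  · simp

namespace Mediator

variable {I : Type w} [Fintype I] {Ω : Type w} [Fintype Ω] {K A : I → Type w}
  [∀ i, Fintype (A i)] [∀ i, Fintype (K i)] {D : Mediator Ω K A}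

section Nonempty

variable [∀ i, Nonempty (A i)]

theorem mem_terminalsAfter_node {ω : Ω} {a : (i : I) → A i} {k : ℕ} (hk : k ≤ Fintype.card I)
    {z : List (Move Ω A)} : z ∈ D.tree.terminalsAfter (D.node ω a k) ↔
      ∃ a', (∀ j, (D.ord ω j : ℕ) < k → a' j = a j) ∧ z = D.node ω a' (Fintype.card I) := by
  have : Nonempty Ω := ⟨ω⟩
  rw [GameTree.mem_terminalsAfter]
  constructor
  · rintro ⟨hz, hp⟩
    obtain ⟨ω', a', rfl⟩ := mem_terminals.1 hz
    rcases prefix_node hp with h | ⟨k', hk', h⟩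
    · exact absurd h node_ne_nil
    · obtain ⟨rfl, rfl, h'⟩ := node_inj hk (hk'.trans le_rfl) h
      exact ⟨a', fun j hj => (h' j hj).symm, rfl⟩
  · rintro ⟨a', h, rfl⟩
    refine ⟨mem_terminals.2 ⟨ω, a', rfl⟩, ?_⟩
    rw [← node_congr h, node, node, List.cons_prefix_cons]
    exact ⟨rfl, List.take_prefix_take_left hk⟩

/-- The outcome records the action of `i` directly; a second action of `i` shows that the matter was
still open. -/
theorem represents_iff [∀ i, Nontrivial (A i)] [Nonempty Ω]
    (u : I → ((i : I) → A i) → ℝ) (hD : D.chance ∈ stdSimplex ℝ Ω) {ω : Ω} {a : (i : I) → A i}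
    {i : I} {m : Move Ω A} {b : A i} :
    (D.game u hD).Represents D.outcome i (D.node ω a (D.ord ω i)) m b ↔ m = Sum.inr ⟨i, b⟩ := by
  classical
  have hterm : ∀ c, ∀ z, z ∈ (D.game u hD).terminalsAfter
      (D.node ω a (D.ord ω i) ++ [Sum.inr ⟨i, c⟩]) → D.outcome z i = c := by
    intro c z hz
    rw [node_append] at hz
    obtain ⟨a', h, rfl⟩ := (mem_terminalsAfter_node (D.ord ω i).2).1 hz
    rw [outcome_node, h i (Nat.lt_succ_self _), Function.update_self]
  have hex : ∀ c, D.node ω (Function.update a i c) (Fintype.card I) ∈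
      (D.game u hD).terminalsAfter (D.node ω a (D.ord ω i) ++ [Sum.inr ⟨i, c⟩]) := by
    intro c
    rw [node_append]
    exact (mem_terminalsAfter_node (D.ord ω i).2).2 ⟨_, fun _ _ => rfl, rfl⟩
  constructor
  · rintro ⟨hm, h, -⟩
    obtain ⟨c, rfl⟩ := mem_moves_node.1 hm
    rw [← hterm c _ (hex c), h _ (hex c)]
  · rintro rfl
    obtain ⟨c, hc⟩ := exists_ne b
    refine ⟨mem_moves_node.2 ⟨b, rfl⟩, hterm b, Sum.inr ⟨i, c⟩, mem_moves_node.2 ⟨c, rfl⟩,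
      _, hex c, ?_⟩
    rwa [hterm c _ (hex c)]

theorem isMechanism [∀ i, Nontrivial (A i)] [Nonempty Ω] (u : I → ((i : I) → A i) → ℝ)
    (hD : D.chance ∈ stdSimplex ℝ Ω) : (D.game u hD).IsMechanism u D.outcome := by
  have hpiv : ∀ (ω : Ω) (a : (i : I) → A i) (i : I),
      (D.game u hD).IsPivotal D.outcome i (D.node ω a (D.ord ω i)) := fun ω a i =>
    ⟨⟨⟨i, D.msg ω i a⟩, rfl, mem_nodesOf.2 ⟨ω, a, rfl, rfl⟩⟩, fun b =>
      ⟨_, (represents_iff u hD).2 rfl⟩⟩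
  refine ⟨⟨fun a => ⟨D.node (Classical.arbitrary Ω) a (Fintype.card I), mem_terminals.2
    ⟨_, _, rfl⟩, outcome_node _ _⟩, fun z _ i => rfl⟩, ?_, ?_⟩
  · rintro ⟨i, κ⟩ y hy y' hy' m b
    obtain ⟨ω, a, -, rfl⟩ := mem_nodesOf.1 hy
    obtain ⟨ω', a', -, rfl⟩ := mem_nodesOf.1 hy'
    exact (represents_iff u hD).trans (represents_iff u hD).symm
  · intro z hz i
    obtain ⟨ω, a, rfl⟩ := mem_terminals.1 hz
    refine ⟨_, _, hpiv ω a i, (represents_iff u hD).2 rfl, ?_⟩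
    rw [outcome_node, ← node_ord_succ]
    exact (mem_terminalsAfter_node (D.ord ω i).2).2 ⟨a, fun _ _ => rfl, rfl⟩

variable [∀ i, DecidableEq (A i)]

/-- The responses that follow the instructions `f` with certainty. -/
def pureResponse (f : (i : I) → K i → A i) (i : I) (κ : K i) : A i → ℝ :=
  Pi.single (f i κ) 1

theorem pureResponse_mem (f : (i : I) → K i → A i) (i : I) (κ : K i) :
    pureResponse f i κ ∈ stdSimplex ℝ (A i) :=
  single_mem_stdSimplex ℝ _

/-- Under pure responses play is deterministic from this node on: a profile that agrees with the
instructions at every remaining visit is the one that results. -/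
theorem expectFrom_node (χ : List (Move Ω A) → Move Ω A → ℝ) (f : (i : I) → K i → A i)
    (F : List (Move Ω A) → ℝ) {ω : Ω} {a : (i : I) → A i} {k : ℕ} (hk : k ≤ Fintype.card I)
    (h : ∀ i, k ≤ (D.ord ω i : ℕ) → a i = f i (D.msg ω i a)) :
    D.tree.expectFrom χ (behavior (pureResponse f)) (D.node ω a k) F =
      F (D.node ω a (Fintype.card I)) := by
  induction hk using Nat.decreasingInduction with
  | self =>
    exact D.tree.expectFrom_of_terminal _ _
      (D.tree.mem_terminals.2 ⟨node_mem le_rfl, moves_node_card⟩) F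
  | of_succ k hk ih =>
    obtain ⟨i, rfl⟩ := D.exists_ord_eq ω hk
    rw [D.tree.expectFrom_step _ _ moves_node_nonempty, moves_node_eq, sum_movesAt,
      Finset.sum_eq_single (a i)]
    · have hs : D.tree.stepProb χ (behavior (pureResponse f)) (D.node ω a (D.ord ω i))
          (Sum.inr ⟨i, a i⟩) = 1 := by
        have h' : D.tree.infoSet (D.node ω a (D.ord ω i)) = some ⟨i, D.msg ω i a⟩ :=
          infoSet_node ω a i
        simp only [GameTree.stepProb, h', behavior_inr, pureResponse, ← h i le_rfl,
          Pi.single_eq_same]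
      rw [hs, one_mul, ← node_ord_succ]
      exact ih fun j hj => h j (by omega)
    · intro c _ hc
      have hs : D.tree.stepProb χ (behavior (pureResponse f)) (D.node ω a (D.ord ω i))
          (Sum.inr ⟨i, c⟩) = 0 := by
        have h' : D.tree.infoSet (D.node ω a (D.ord ω i)) = some ⟨i, D.msg ω i a⟩ :=
          infoSet_node ω a i
        simp only [GameTree.stepProb, h', behavior_inr, pureResponse, ← h i le_rfl,
          Pi.single_eq_of_ne hc]
      rw [hs, zero_mul]
    · simp

theorem expectFrom_root [Nonempty Ω] (p : Ω → ℝ) (f : (i : I) → K i → A i) (F : List (Move Ω A) → ℝ)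
    (a : Ω → (i : I) → A i) (h : ∀ ω, p ω ≠ 0 → ∀ i, a ω i = f i (D.msg ω i (a ω))) :
    D.tree.expectFrom (chanceBehavior p) (behavior (pureResponse f)) [] F =
      ∑ ω, p ω * F (D.node ω (a ω) (Fintype.card I)) := by
  rw [D.tree.expectFrom_step _ _ ⟨_, mem_moves_nil.2 ⟨Classical.arbitrary Ω, rfl⟩⟩, sum_moves_nil]
  refine Finset.sum_congr rfl fun ω _ => ?_
  have h' : D.tree.infoSet [] = none := infoSet_nil
  simp only [GameTree.stepProb, h', chanceBehavior]
  by_cases hp : p ω = 0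
  · rw [hp, zero_mul, zero_mul]
  · rw [List.nil_append, ← node_zero (D := D) ω (a ω),
      expectFrom_node _ f F (Nat.zero_le _) fun i _ => h ω hp i]

/-- The profile `a` is what happens from the `k`-th visit on, in the state `ω`, if the visits before
went according to `a'` and the players follow `f` from there on. -/
def Follows (D : Mediator Ω K A) (f : (i : I) → K i → A i) (ω : Ω) (i : I) (a' a : (i : I) → A i) :
    Prop :=
  (∀ j, D.ord ω j < D.ord ω i → a j = a' j) ∧
    ∀ j, D.ord ω i < D.ord ω j → a j = f j (D.msg ω j a)

theorem continuationPayoff_eq (u : I → ((i : I) → A i) → ℝ) (hD : D.chance ∈ stdSimplex ℝ Ω)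
    (f : (i : I) → K i → A i) {ω : Ω} {i : I} {a' a : (i : I) → A i} (h : D.Follows f ω i a' a) :
    (D.game u hD).continuationPayoff (behavior (pureResponse f)) i
      (D.node ω a' (D.ord ω i) ++ [Sum.inr ⟨i, a i⟩]) = u i a := by
  have h1 : D.node ω a' (D.ord ω i) = D.node ω a (D.ord ω i) :=
    node_congr fun j hj => (h.1 j hj).symm
  rw [h1, ← node_ord_succ]
  refine (expectFrom_node _ f _ (D.ord ω i).2 fun j hj => h.2 j hj).trans ?_
  change u i (D.outcome _) = _
  rw [outcome_node]

/-! ### Pure strategies -/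

variable (u : I → ((i : I) → A i) → ℝ) (hD : D.chance ∈ stdSimplex ℝ Ω)

/-- The pure strategy of `i` that follows the instructions `f`. -/
def pureStrategy (f : (i : I) → K i → A i) (i : I) : (D.game u hD).PureStrategy i :=
  fun h => ⟨Sum.inr ⟨h.1.1, f h.1.1 h.1.2⟩, mem_movesAt.2 ⟨_, rfl⟩⟩

theorem pureBehavior_eq (s : (i : I) → (D.game u hD).PureStrategy i) (f : (i : I) → K i → A i)
    (h : ∀ i κ, (s i ⟨⟨i, κ⟩, rfl⟩ : Move Ω A) = Sum.inr ⟨i, f i κ⟩) :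
    (D.game u hD).pureBehavior s = behavior (pureResponse f) := by
  classical
  funext ⟨i, κ⟩ m
  have hs : (D.game u hD).pureBehavior s ⟨i, κ⟩ m =
      if (Sum.inr ⟨i, f i κ⟩ : Move Ω A) = m then 1 else 0 := by
    by_cases hm : (s i ⟨⟨i, κ⟩, rfl⟩ : Move Ω A) = m
    · rw [if_pos (by rw [← h, hm])]
      exact @if_pos _ _ hm _ _ _
    · rw [if_neg (by rwa [← h])]
      exact @if_neg _ _ hm _ _ _
  rw [hs]
  rcases m with ω | ⟨j, c⟩
  · simp [behavior]
  · by_cases hj : j = i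
    · subst hj
      rw [behavior_inr, pureResponse, Pi.single_apply]
      refine if_congr ?_ rfl rfl
      simp [eq_comm]
    · rw [if_neg]
      · simp [behavior, hj]
      · simp only [Sum.inr.injEq, Sigma.mk.injEq, not_and]
        exact fun h => absurd h.symm hj

theorem exists_instructions {i : I} (t : (D.game u hD).PureStrategy i) :
    ∃ g : K i → A i, ∀ κ, (t ⟨⟨i, κ⟩, rfl⟩ : Move Ω A) = Sum.inr ⟨i, g κ⟩ := by
  have h : ∀ κ : K i, ∃ c, (t ⟨⟨i, κ⟩, rfl⟩ : Move Ω A) = Sum.inr ⟨i, c⟩ := fun κ =>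
    mem_movesAt.1 (t ⟨⟨i, κ⟩, rfl⟩).2
  choose g hg using h
  exact ⟨g, hg⟩

end Nonempty

/-! ### Equilibria -/

section Equilibria

variable [∀ i, DecidableEq (A i)] [∀ i, Nontrivial (A i)] [Nonempty Ω]

open Classical in
-- A criterion in terms of states. After rescaling by `s i κ`, the tremble probabilities of the
-- nodes in the information set `(i, κ)` converge to `L i κ` on the nodes where the earlier players
-- have played `base`, and to zero elsewhere. The belief is `L i κ` normalized, so optimality
-- compares the outcomes `out ω i c` averaged over states. Information sets of very different
-- probability can be treated alike, because each has its own scale.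
theorem exists_isSequentialEquilibrium (u : I → ((i : I) → A i) → ℝ)
    (hD : D.chance ∈ stdSimplex ℝ Ω) (f : (i : I) → K i → A i) (base : Ω → (i : I) → A i)
    (out : Ω → (i : I) → A i → (i : I) → A i) (hout : ∀ ω i c, out ω i c i = c)
    (w : ℕ → Ω → ℝ) (hw : ∀ n, w n ∈ stdSimplex ℝ Ω) (hw0 : ∀ n ω, 0 < w n ω)
    (hwlim : ∀ ω, Tendsto (fun n => w n ω) atTop (𝓝 (D.chance ω)))
    (q : ℕ → (i : I) → K i → A i → ℝ) (hq : ∀ n i κ, q n i κ ∈ stdSimplex ℝ (A i))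
    (hq0 : ∀ n i κ c, 0 < q n i κ c)
    (hqlim : ∀ i κ c, Tendsto (fun n => q n i κ c) atTop (𝓝 (pureResponse f i κ c)))
    (s : (i : I) → K i → ℕ → ℝ) (hs : ∀ i κ n, s i κ n ≠ 0) (L : (i : I) → K i → Ω → ℝ)
    (hL : ∀ i κ ω a, D.msg ω i a = κ → Tendsto (fun n => s i κ n *
        (w n ω * ∏ j with D.ord ω j < D.ord ω i, q n j (D.msg ω j a) (a j))) atTop
      (𝓝 (if ∀ j, D.ord ω j < D.ord ω i → base ω j = a j then L i κ ω else 0)))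
    (hsupp : ∀ i κ ω, L i κ ω ≠ 0 → D.msg ω i (base ω) = κ ∧
      ∀ c, D.Follows f ω i (base ω) (out ω i c))
    (hpos : ∀ i κ, 0 < ∑ ω, L i κ ω)
    (hopt : ∀ i κ c, ∑ ω, L i κ ω * u i (out ω i c) ≤ ∑ ω, L i κ ω * u i (out ω i (f i κ))) :
    ∃ ψ, (D.game u hD).IsSequentialEquilibrium ψ (behavior (pureResponse f)) := by
  -- The weights are carried from states to nodes. Different states give different nodes, so at most
  -- one summand is nonzero.
  let ℓ : (Σ i, K i) → List (Move Ω A) → ℝ := fun h y =>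
    ∑ ω, if D.node ω (base ω) (D.ord ω h.1) = y then L h.1 h.2 ω else 0
  have hsum : ∀ i κ (X : List (Move Ω A) → ℝ), ∑ y ∈ D.tree.nodesOf ⟨i, κ⟩, ℓ ⟨i, κ⟩ y * X y =
      ∑ ω, L i κ ω * X (D.node ω (base ω) (D.ord ω i)) := by
    intro i κ X
    simp only [ℓ, Finset.sum_mul]
    rw [Finset.sum_comm]
    refine Finset.sum_congr rfl fun ω _ => ?_
    simp only [ite_mul, zero_mul]
    rw [Finset.sum_ite_eq]
    by_cases h0 : L i κ ω = 0
    · simp [h0]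
    · rw [if_pos (mem_nodesOf.2 ⟨ω, base ω, (hsupp i κ ω h0).1, rfl⟩)]
  have hℓ : ∀ i κ, ∑ y ∈ D.tree.nodesOf ⟨i, κ⟩, ℓ ⟨i, κ⟩ y = ∑ ω, L i κ ω := by
    intro i κ
    simpa using hsum i κ (fun _ => 1)
  have hlim : ∀ i κ, ∀ y ∈ D.tree.nodesOf ⟨i, κ⟩, Tendsto (fun n => s i κ n *
      D.tree.nodeProb (chanceBehavior (w n)) (behavior (q n)) y) atTop (𝓝 (ℓ ⟨i, κ⟩ y)) := by
    intro i κ y hy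
    obtain ⟨ω, a, hm, rfl⟩ := mem_nodesOf.1 hy
    simp only [nodeProb_node _ _ _ _ (ord_le (D := D)), Fin.val_fin_lt]
    convert hL i κ ω a hm using 2
    simp only [ℓ]
    rw [Finset.sum_eq_single ω]
    · refine if_congr ⟨fun h => (node_inj ord_le ord_le h).2.2, fun h => node_congr h⟩ rfl rfl
    · intro ω' _ hne
      rw [if_neg]
      exact fun h => hne (node_inj ord_le ord_le h).1
    · simp
  refine ⟨fun h y => ℓ h y / ∑ ω, L h.1 h.2 ω, isBehavior (pureResponse_mem f),
    ⟨fun n => behavior (q n), fun n => chanceBehavior (w n), fun n => ⟨isBehavior (hq n), ?_⟩,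
      fun n => ⟨isNatureBehavior (hw n), ?_⟩, ?_, ?_, ?_⟩, ?_⟩
  · rintro ⟨i, κ⟩ m hm
    obtain ⟨c, rfl⟩ := mem_movesAt.1 hm
    simp only [behavior_inr]
    exact hq0 n i κ c
  · intro x hx m hm
    obtain rfl := mem_natureNodes.1 hx
    obtain ⟨ω, rfl⟩ := mem_moves_nil.1 hm
    exact hw0 n ω
  · rintro ⟨i, κ⟩ m hm
    obtain ⟨c, rfl⟩ := mem_movesAt.1 hm
    simp only [behavior_inr]
    exact hqlim i κ c
  · intro x hx m hm
    obtain rfl := mem_natureNodes.1 hx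
    obtain ⟨ω, rfl⟩ := mem_moves_nil.1 hm
    exact hwlim ω
  · rintro ⟨i, κ⟩ y hy
    have h1 := (hlim i κ y hy).div (tendsto_finsetSum _ (hlim i κ))
      (by rw [hℓ]; exact (hpos i κ).ne')
    rw [hℓ] at h1
    refine h1.congr fun n => ?_
    simp only [Pi.div_apply]
    -- The scale cancels in Bayes' rule.
    rw [← Finset.mul_sum, mul_div_mul_left _ _ (hs i κ n)]
    rfl
  · rintro ⟨i, κ⟩ m hm hm0 m' hm'
    obtain ⟨c, rfl⟩ := mem_movesAt.1 hm
    obtain ⟨c', rfl⟩ := mem_movesAt.1 hm'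
    rw [behavior_inr, pureResponse] at hm0
    obtain rfl : c = f i κ := by
      by_contra hc
      rw [Pi.single_eq_of_ne hc] at hm0
      exact lt_irrefl _ hm0
    have hint : ∀ c, (D.game u hD).interimPayoff (fun h y => ℓ h y / ∑ ω, L h.1 h.2 ω)
        (behavior (pureResponse f)) ⟨i, κ⟩ (Sum.inr ⟨i, c⟩) =
        (∑ ω, L i κ ω * u i (out ω i c)) / ∑ ω, L i κ ω := by
      intro c
      let X : List (Move Ω A) → ℝ := fun y =>
        (D.game u hD).continuationPayoff (behavior (pureResponse f)) i (y ++ [Sum.inr ⟨i, c⟩])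
      have h1 : (D.game u hD).interimPayoff (fun h y => ℓ h y / ∑ ω, L h.1 h.2 ω)
          (behavior (pureResponse f)) ⟨i, κ⟩ (Sum.inr ⟨i, c⟩) =
          ∑ y ∈ D.tree.nodesOf ⟨i, κ⟩, ℓ ⟨i, κ⟩ y / (∑ ω, L i κ ω) * X y := rfl
      have h2 : ∀ ω, L i κ ω ≠ 0 → X (D.node ω (base ω) (D.ord ω i)) = u i (out ω i c) := by
        intro ω h0
        have h := continuationPayoff_eq u hD f ((hsupp i κ ω h0).2 c)
        rwa [hout] at h
      rw [h1]
      clear_value X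
      have h3 : ∑ ω, L i κ ω * u i (out ω i c) =
          ∑ ω, L i κ ω * X (D.node ω (base ω) (D.ord ω i)) := by
        refine Finset.sum_congr rfl fun ω _ => ?_
        by_cases h0 : L i κ ω = 0
        · rw [h0, zero_mul, zero_mul]
        · rw [h2 ω h0]
      rw [h3, ← hsum i κ X, Finset.sum_div]
      refine Finset.sum_congr rfl fun y _ => ?_
      rw [div_mul_eq_mul_div]
    rw [hint, hint]
    exact div_le_div_of_nonneg_right (hopt i κ c') (hpos i κ).le

theorem sum_nodeProb_mul_outcome (f : (i : I) → K i → A i) (base : Ω → (i : I) → A i)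
    (hbase : ∀ ω, D.chance ω ≠ 0 → ∀ i, base ω i = f i (D.msg ω i (base ω)))
    (F : ((i : I) → A i) → ℝ) :
    ∑ z ∈ D.tree.terminals, D.tree.nodeProb (chanceBehavior D.chance)
      (behavior (pureResponse f)) z * F (D.outcome z) = ∑ ω, D.chance ω * F (base ω) := by
  rw [← GameTree.expectFrom_nil D.tree _ _ fun z => F (D.outcome z),
    expectFrom_root D.chance f _ base hbase]
  simp only [outcome_node]

open Classical in
theorem sum_nodeProb_outcome (u : I → ((i : I) → A i) → ℝ) (hD : D.chance ∈ stdSimplex ℝ Ω)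
    (f : (i : I) → K i → A i) (base : Ω → (i : I) → A i)
    (hbase : ∀ ω, D.chance ω ≠ 0 → ∀ i, base ω i = f i (D.msg ω i (base ω))) (a : (i : I) → A i) :
    ∑ z ∈ (D.game u hD).terminals with D.outcome z = a,
      (D.game u hD).nodeProb (D.game u hD).chance (behavior (pureResponse f)) z =
    ∑ ω with base ω = a, D.chance ω := by
  have h := sum_nodeProb_mul_outcome f base hbase fun a' => if a' = a then 1 else 0
  simp only [mul_ite, mul_one, mul_zero] at h
  rw [Finset.sum_filter, Finset.sum_filter]
  exact h

open Classical in
theorem sequentiallyImplementable (u : I → ((i : I) → A i) → ℝ)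
    (hD : D.chance ∈ stdSimplex ℝ Ω) (f : (i : I) → K i → A i) (base : Ω → (i : I) → A i)
    (hbase : ∀ ω, D.chance ω ≠ 0 → ∀ i, base ω i = f i (D.msg ω i (base ω)))
    {α : ((i : I) → A i) → ℝ}
    (hα : ∀ a, α a = ∑ ω with base ω = a, D.chance ω)
    (hE : ∃ ψ, (D.game u hD).IsSequentialEquilibrium ψ (behavior (pureResponse f))) :
    SequentiallyImplementable u α := by
  obtain ⟨ψ, hψ⟩ := hE
  refine ⟨_, _, inferInstance, inferInstance, D.game u hD, D.outcome, isMechanism u hD, ψ, _, hψ,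
    fun a => ?_⟩
  rw [hα a, ← sum_nodeProb_outcome u hD f base hbase]
  exact Finset.sum_congr (by congr) fun _ _ => rfl

open Classical in
-- Only states of positive probability matter. In them a deviator sees the message he would get on
-- path, so each message can be treated on its own.
theorem nashImplementable (u : I → ((i : I) → A i) → ℝ)
    (hD : D.chance ∈ stdSimplex ℝ Ω) (f : (i : I) → K i → A i) (base : Ω → (i : I) → A i)
    (hbase : ∀ ω, D.chance ω ≠ 0 → ∀ i, base ω i = f i (D.msg ω i (base ω)))
    {α : ((i : I) → A i) → ℝ}
    (hα : ∀ a, α a = ∑ ω with base ω = a, D.chance ω)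
    (out : Ω → (i : I) → A i → (i : I) → A i) (hout : ∀ ω i c, out ω i c i = c)
    (hfol : ∀ ω, D.chance ω ≠ 0 → ∀ i c, D.Follows f ω i (base ω) (out ω i c))
    (hopt : ∀ i κ c, ∑ ω with D.msg ω i (base ω) = κ, D.chance ω * u i (out ω i c) ≤
      ∑ ω with D.msg ω i (base ω) = κ, D.chance ω * u i (base ω)) :
    NashImplementable u α := by
  let G := D.game u hD
  let s₀ : (i : I) → G.PureStrategy i := pureStrategy u hD f
  have hs₀ : G.pureBehavior s₀ = behavior (pureResponse f) :=
    pureBehavior_eq u hD _ f fun i κ => rfl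
  let μ : (i : I) → G.PureStrategy i → ℝ := fun i => Pi.single (s₀ i) 1
  have hμ : ∀ z, G.mixedNodeProb μ z = G.nodeProb G.chance (behavior (pureResponse f)) z := by
    intro z
    rw [← hs₀]
    exact sum_prod_pi_single s₀ fun s => G.nodeProb G.chance (G.pureBehavior s) z
  refine ⟨_, _, inferInstance, inferInstance, G, D.outcome, isMechanism u hD, μ,
    ⟨fun i => single_mem_stdSimplex ℝ _, fun i ν hν => ?_⟩, fun a => ?_⟩
  · have hpay : G.mixedPayoff μ i = ∑ ω, D.chance ω * u i (base ω) := by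
      rw [ExtensiveGame.mixedPayoff]
      simp only [hμ]
      rw [← GameTree.expectFrom_nil]
      refine (expectFrom_root D.chance f _ base hbase).trans (Finset.sum_congr rfl fun ω _ => ?_)
      change _ * u i (D.outcome _) = _
      rw [outcome_node]
    rw [ExtensiveGame.mixedPayoff_eq]
    refine (sum_prod_update_pi_single s₀ i ν fun s => G.expectFrom G.chance (G.pureBehavior s) []
      fun z => G.payoff z i).trans_le ?_
    have hdev : ∀ t, G.expectFrom G.chance (G.pureBehavior (Function.update s₀ i t)) []
        (fun z => G.payoff z i) ≤ G.mixedPayoff μ i := by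
      intro t
      obtain ⟨g, hg⟩ := exists_instructions u hD t
      rw [pureBehavior_eq u hD _ (Function.update f i g)]
      swap
      · intro j κ
        by_cases hj : j = i
        · subst hj
          simp only [Function.update_self]
          exact hg κ
        · simp only [Function.update_of_ne hj]
          rfl
      -- `out` is what happens when `i` uses `g`: his predecessors do not notice and play `base`, he
      -- answers the same message as before, and his successors react as in `Follows`.
      have hrec : ∀ ω, D.chance ω ≠ 0 → ∀ j, out ω i (g (D.msg ω i (base ω))) j =
          Function.update f i g j (D.msg ω j (out ω i (g (D.msg ω i (base ω))))) := by
        intro ω hω j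
        obtain ⟨h1, h2⟩ := hfol ω hω i (g (D.msg ω i (base ω)))
        rcases lt_trichotomy (D.ord ω j) (D.ord ω i) with hj | hj | hj
        · rw [Function.update_of_ne (by rintro rfl; exact lt_irrefl _ hj), h1 j hj,
            D.msg_congr ω j _ (base ω) fun k hk => h1 k (hk.trans hj), hbase ω hω j,
            ← hbase ω hω j]
        · obtain rfl := (D.ord ω).injective hj
          rw [hout, Function.update_self, D.msg_congr ω j _ (base ω) fun k hk => h1 k hk]
        · rw [Function.update_of_ne (by rintro rfl; exact lt_irrefl _ hj), h2 j hj]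
      refine (expectFrom_root D.chance _ _ _ hrec).trans_le ?_
      rw [hpay, ← Finset.sum_fiberwise _ (fun ω => D.msg ω i (base ω)),
        ← Finset.sum_fiberwise _ (fun ω => D.msg ω i (base ω))]
      refine Finset.sum_le_sum fun κ _ => le_trans (le_of_eq ?_) (hopt i κ (g κ))
      refine Finset.sum_congr rfl fun ω hω => ?_
      change _ * u i (D.outcome _) = _
      rw [outcome_node, (Finset.mem_filter.1 hω).2]
    calc ∑ t, ν t * _ ≤ ∑ t, ν t * G.mixedPayoff μ i :=
        Finset.sum_le_sum fun t _ => mul_le_mul_of_nonneg_left (hdev t) (hν.1 t)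
      _ = G.mixedPayoff μ i := by rw [← Finset.sum_mul, hν.2, one_mul]
  · rw [hα a, ← sum_nodeProb_outcome u hD f base hbase]
    exact Finset.sum_congr (by congr) fun z _ => (hμ z).symm

end Equilibria

end Mediator
end ChoiceInterdependence

/-! ### Beliefs for undominated actions, and the mediator for an ICE -/

namespace ChoiceInterdependence

/-- Gordan's alternative: if no mixture of the vectors `g c` is positive, then some weights make
all of them nonpositive. -/
theorem exists_weights_of_no_positive_mixture {C X : Type*} [Fintype C] [Nonempty C] [Fintype X]
    (g : C → X → ℝ) (h : ¬ ∃ β ∈ stdSimplex ℝ C, ∀ x, 0 < ∑ c, β c * g c x) :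
    ∃ ν ∈ stdSimplex ℝ X, ∀ c, ∑ x, ν x * g c x ≤ 0 := by
  classical
  let s : Set (X → ℝ) := {y | ∀ x, 0 < y x}
  let t : Set (X → ℝ) := Fintype.linearCombination ℝ g '' stdSimplex ℝ C
  have hs : Convex ℝ s := by
    intro y hy z hz p q hp hq hpq x
    have h1 := hy x
    have h2 := hz x
    simp only [Pi.add_apply, Pi.smul_apply, smul_eq_mul]
    rcases hp.eq_or_lt with rfl | hp
    · obtain rfl : q = 1 := by linarith
      simpa using h2
    · exact add_pos_of_pos_of_nonneg (mul_pos hp h1) (mul_nonneg hq h2.le)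
  have hso : IsOpen s := by
    have : s = ⋂ x, {y | 0 < y x} := by ext; simp [s]
    rw [this]
    exact isOpen_iInter_of_finite fun x => isOpen_lt continuous_const (continuous_apply x)
  have ht : Convex ℝ t := (convex_stdSimplex ℝ C).linear_image _
  have hst : Disjoint s t := by
    rw [Set.disjoint_left]
    rintro y hy ⟨β, hβ, rfl⟩
    refine h ⟨β, hβ, fun x => ?_⟩
    have := hy x
    simpa [Fintype.linearCombination_apply] using this
  -- The open positive orthant is separated from the mixtures of the `g c`. The functional turns out
  -- to have nonpositive coordinates, and dividing them by their negative sum gives the weights.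
  obtain ⟨φ, r, hφs, hφt⟩ := geometric_hahn_banach_open hs hso ht hst
  have hφ : ∀ y, φ y = ∑ x, y x * φ (Pi.single x 1) := by
    intro y
    conv_lhs => rw [← Finset.univ_sum_single y]
    rw [map_sum]
    refine Finset.sum_congr rfl fun x _ => ?_
    rw [← smul_eq_mul, ← map_smul]
    congr 1
    ext x'
    simp [Pi.single_apply]
  have h1 : φ 1 < r := hφs 1 fun x => by simp
  have hr : 0 ≤ r := by
    by_contra hr
    push Not at hr
    -- If `r < 0`, this positive multiple of the all-ones vector has value exactly `r`, against the
    -- strict inequality on the orthant.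
    have h2 := hφs ((r / φ 1) • 1) fun x => by
      simpa using div_pos_of_neg_of_neg hr (h1.trans hr)
    rw [map_smul, smul_eq_mul, div_mul_cancel₀ _ (h1.trans hr).ne] at h2
    exact lt_irrefl _ h2
  have hneg : ∀ x, φ (Pi.single x 1) ≤ 0 := by
    intro x
    by_contra hx
    push Not at hx
    -- A positive coordinate of `φ` would let a ray inside the orthant, starting at the all-ones
    -- vector, reach the value `r`.
    have h2 := hφs (((r - φ 1) / φ (Pi.single x 1)) • Pi.single x 1 + 1) fun x' => by
      have h3 : 0 ≤ (r - φ 1) / φ (Pi.single x 1) := div_nonneg (by linarith) hx.le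
      have h4 : (0 : ℝ) ≤ (Pi.single x 1 : X → ℝ) x' := by
        rw [Pi.single_apply]; split <;> norm_num
      simp only [Pi.add_apply, Pi.smul_apply, smul_eq_mul, Pi.one_apply]
      positivity
    rw [map_add, map_smul, smul_eq_mul, div_mul_cancel₀ _ hx.ne'] at h2
    linarith
  have hpos : ∀ c, 0 ≤ φ (g c) := fun c => hr.trans (hφt _
    ⟨Pi.single c 1, single_mem_stdSimplex ℝ c, by
      simp [Fintype.linearCombination_apply, Pi.single_apply]⟩)
  have hsum : ∑ x, φ (Pi.single x 1) < 0 := by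
    refine lt_of_le_of_ne (Finset.sum_nonpos fun x _ => hneg x) fun h0 => ?_
    rw [Finset.sum_eq_zero_iff_of_nonpos fun x _ => hneg x] at h0
    have h0' : ∀ y, φ y = 0 := fun y => by
      rw [hφ y]
      exact Finset.sum_eq_zero fun x hx => by rw [h0 x hx, mul_zero]
    have h2 := hφt _ ⟨Pi.single (Classical.arbitrary C) 1, single_mem_stdSimplex ℝ _, rfl⟩
    rw [h0'] at h1 h2
    linarith
  refine ⟨fun x => φ (Pi.single x 1) / ∑ x, φ (Pi.single x 1),
    ⟨fun x => div_nonneg_of_nonpos (hneg x) hsum.le, ?_⟩, fun c => ?_⟩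
  · rw [← Finset.sum_div, div_self hsum.ne]
  · have h2 : ∑ x, φ (Pi.single x 1) / (∑ x, φ (Pi.single x 1)) * g c x =
        φ (g c) / ∑ x, φ (Pi.single x 1) := by
      rw [hφ (g c), Finset.sum_div]
      exact Finset.sum_congr rfl fun x _ => by ring
    rw [h2]
    exact div_nonpos_of_nonneg_of_nonpos (hpos c) hsum.le

theorem exists_enumeration_last {I : Type w} [Fintype I] (i : I) :
    ∃ r : Enumeration I, ∀ j, r j < r i ↔ j ≠ i := by
  classical
  have hn : 0 < Fintype.card I := Fintype.card_pos_iff.2 ⟨i⟩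
  let e := Fintype.equivFin I
  let l : Fin (Fintype.card I) := ⟨Fintype.card I - 1, by omega⟩
  refine ⟨e.trans (Equiv.swap (e i) l), fun j => ?_⟩
  have hi : (e.trans (Equiv.swap (e i) l)) i = l := by simp
  rw [hi]
  constructor
  · rintro h rfl
    rw [hi] at h
    exact lt_irrefl _ h
  · intro h
    have h1 : (e.trans (Equiv.swap (e i) l)) j ≠ l := by
      intro h'
      exact h ((e.trans (Equiv.swap (e i) l)).injective (h'.trans hi.symm))
    have h2 : ((e.trans (Equiv.swap (e i) l)) j : ℕ) ≠ Fintype.card I - 1 := fun h' =>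
      h1 (Fin.ext h')
    rw [Fin.lt_def]
    have h3 := ((e.trans (Equiv.swap (e i) l)) j).2
    change _ < Fintype.card I - 1
    omega

section

variable {I : Type w} [Fintype I] [DecidableEq I] {A : I → Type w} [∀ i, Fintype (A i)]
  [∀ i, DecidableEq (A i)]

/-- Gordan's alternative applied to the gains from replacing `b` by `c`. The belief is over full
profiles and may be correlated; the coordinate of `i` is overwritten and plays no role. -/
theorem exists_belief_of_not_strictlyDominated {u : I → ((i : I) → A i) → ℝ} {i : I} {b : A i}
    (h : ¬ StrictlyDominated u i b) : ∃ ν ∈ stdSimplex ℝ ((i : I) → A i), ∀ c,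
      ∑ a, ν a * u i (Function.update a i c) ≤ ∑ a, ν a * u i (Function.update a i b) := by
  have : Nonempty (A i) := ⟨b⟩
  obtain ⟨ν, hν, hν'⟩ := exists_weights_of_no_positive_mixture
    (fun (c : A i) (a : (i : I) → A i) => u i (Function.update a i c) - u i (Function.update a i b))
    (by
      rintro ⟨β, hβ, hβ'⟩
      refine h ⟨β, hβ, fun a => ?_⟩
      have h1 := hβ' a
      simp only [mul_sub, Finset.sum_sub_distrib] at h1
      rw [← Finset.sum_mul, hβ.2, one_mul] at h1
      linarith)
  refine ⟨ν, hν, fun c => ?_⟩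
  have h1 := hν' c
  simp only [mul_sub, Finset.sum_sub_distrib] at h1
  linarith

/-- The data of the mediated game that implements the interdependent-choice equilibrium `α`. -/
structure Scheme (u : I → ((i : I) → A i) → ℝ) (α : ((i : I) → A i) → ℝ) where
  mem : α ∈ stdSimplex ℝ ((i : I) → A i)
  θ : ((i : I) → A i) → Enumeration I → ℝ
  θ_mem : ∀ a, θ a ∈ stdSimplex ℝ (Enumeration I)
  /-- `punish a r i c` is the outcome if `i` deviates to `c` -/
  punish : ((i : I) → A i) → Enumeration I → (i : I) → A i → (i : I) → A i
  punish_self : ∀ a r i c, punish a r i c i = c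
  punish_before : ∀ a r i c j, r j < r i → punish a r i c j = a j
  compatible : ∀ i (b c : A i), ∑ a with a i = b, α a * ∑ r, θ a r * u i (punish a r i c) ≤
    ∑ a with a i = b, α a * u i a
  /-- a profile that occurs -/
  ref : (i : I) → A i
  ref_pos : 0 < α ref
  /-- an order in which `i` moves last -/
  last : I → Enumeration I
  last_lt : ∀ i j, last i j < last i i ↔ j ≠ i
  /-- a belief that justifies an action -/
  belief : (i : I) → A i → ((i : I) → A i) → ℝ
  belief_mem : ∀ i b, belief i b ∈ stdSimplex ℝ ((i : I) → A i)
  belief_best : ∀ i (b c : A i), ∑ a, belief i b a * u i (Function.update a i c) ≤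
    ∑ a, belief i b a * u i (Function.update a i b)
  /-- a best response to the profile that occurs -/
  best : (i : I) → A i
  best_best : ∀ i c, u i (Function.update ref i c) ≤ u i (Function.update ref i (best i))

/-- The profiles `punish` attain the minima in the worst payoffs. The absence of dominated actions
is what supplies `belief`. -/
theorem IsICE.exists_scheme {u : I → ((i : I) → A i) → ℝ} {α : ((i : I) → A i) → ℝ}
    [∀ i, Nonempty (A i)] (hdom : ∀ i (b : A i), ¬ StrictlyDominated u i b) (h : IsICE u α) :
    Nonempty (Scheme u α) := by
  obtain ⟨hα, θ, hθ, hic⟩ := h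
  choose punish hp1 hp2 hp3 using fun a r i c => exists_worstPayoff_univ u α r a i c
  choose last hlast using fun i : I => exists_enumeration_last i
  choose belief hb1 hb2 using fun i b => exists_belief_of_not_strictlyDominated (hdom i b)
  obtain ⟨ref, -, href⟩ : ∃ a ∈ Finset.univ, 0 < α a := by
    refine Finset.exists_lt_of_sum_lt (f := fun _ => (0 : ℝ)) ?_
    rw [hα.2]
    simp
  choose best hbest using fun i : I => Finite.exists_max fun c => u i (Function.update ref i c)
  refine ⟨⟨hα, θ, hθ, punish, hp1, hp2, fun i b c => ?_, ref, href, last, hlast, belief, hb1, hb2,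
    best, hbest⟩⟩
  have h1 := hic i b c
  simp only [mul_sub, Finset.sum_sub_distrib] at h1
  simp only [hp3]
  linarith

namespace Scheme

variable {u : I → ((i : I) → A i) → ℝ} {α : ((i : I) → A i) → ℝ} (S : Scheme u α)

/-- The states: a profile to be implemented in some order of the players, a state in which a given
player comes last and is not told anything, and states which justify actions. -/
abbrev State (A : I → Type w) : Type w :=
  (((i : I) → A i) × Enumeration I) ⊕ (I ⊕ ((Σ i, A i) × ((i : I) → A i)))

/-- `k` is the first player who departs from `a` in the profile `x`. -/
def FirstDeviation (a : (i : I) → A i) (r : Enumeration I) (x : (i : I) → A i) (k : I) : Prop :=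
  x k ≠ a k ∧ ∀ l, r l < r k → x l = a l

theorem FirstDeviation.unique {a x : (i : I) → A i} {r : Enumeration I} {k k' : I}
    (h : FirstDeviation a r x k) (h' : FirstDeviation a r x k') : k = k' := by
  rcases lt_trichotomy (r k) (r k') with hl | hl | hl
  · exact absurd (h'.2 k hl) h.1
  · exact r.injective hl
  · exact absurd (h.2 k' hl) h'.1

theorem exists_firstDeviation {a x : (i : I) → A i} {r : Enumeration I} {i : I}
    (h : ¬ ∀ j, r j < r i → x j = a j) : ∃ k, FirstDeviation a r x k ∧ r k < r i := by
  push Not at h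
  obtain ⟨j, hj, hne⟩ := h
  obtain ⟨k, hk, hmin⟩ := Finset.exists_min_image
    (Finset.univ.filter fun k => r k < r i ∧ x k ≠ a k) r ⟨j, by simp [hj, hne]⟩
  simp only [Finset.mem_filter, Finset.mem_univ, true_and] at hk hmin
  refine ⟨k, ⟨hk.2, fun l hl => ?_⟩, hk.1⟩
  by_contra hne'
  exact absurd (hmin l ⟨hl.trans hk.1, hne'⟩) (not_le.2 hl)

/-- The order of the visits. -/
def ord : State A → Enumeration I
  | Sum.inl (_, r) => r
  | Sum.inr (Sum.inl i) => S.last i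
  | Sum.inr (Sum.inr (p, _)) => S.last p.1

open Classical in
/-- The messages: a recommendation, or nothing. -/
noncomputable def msg : State A → (i : I) → ((i : I) → A i) → Option (A i)
  | Sum.inl (a, r), j, x =>
    if h : ∃ k, FirstDeviation a r x k ∧ r k < r j then
      some (S.punish a r h.choose (x h.choose) j) else some (a j)
  | Sum.inr (Sum.inl i), j, _ => if j = i then none else some (S.ref j)
  | Sum.inr (Sum.inr (p, a)), j, x =>
    if j = p.1 then
      -- The update at `p.1` merely moves `p.2` into the type of actions of `j`. If the others miss
      -- `a`, the message is `ref`, an on-path recommendation, whose limiting belief ignores this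
      -- null state.
      if ∀ k, k ≠ p.1 → x k = a k then some (Function.update S.ref p.1 p.2 j) else some (S.ref j)
    else none

theorem msg_of_comply {a x : (i : I) → A i} {r : Enumeration I} {i : I}
    (h : ∀ j, r j < r i → x j = a j) : S.msg (Sum.inl (a, r)) i x = some (a i) := by
  rw [msg, dif_neg]
  rintro ⟨k, hk, hk'⟩
  exact hk.1 (h k hk')

theorem msg_of_firstDeviation {a x : (i : I) → A i} {r : Enumeration I} {i k : I}
    (h : FirstDeviation a r x k) (hk : r k < r i) :
    S.msg (Sum.inl (a, r)) i x = some (S.punish a r k (x k) i) := by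
  have hex : ∃ k, FirstDeviation a r x k ∧ r k < r i := ⟨k, h, hk⟩
  rw [msg, dif_pos hex, hex.choose_spec.1.unique h]

/-- The mediator. -/
noncomputable def mediator : Mediator (State A) (fun i => Option (A i)) A where
  ord := S.ord
  msg := S.msg
  msg_congr := by
    rintro (⟨a, r⟩ | i | ⟨p, a⟩) j x x' h
    · change ∀ k, r k < r j → _ at h
      by_cases hx : ∀ k, r k < r j → x k = a k
      · rw [S.msg_of_comply hx, S.msg_of_comply fun k hk => (h k hk).symm.trans (hx k hk)]
      · obtain ⟨k, hk, hkj⟩ := exists_firstDeviation hx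
        have hk' : FirstDeviation a r x' k :=
          ⟨by rw [← h k hkj]; exact hk.1, fun l hl => (h l (hl.trans hkj)).symm.trans (hk.2 l hl)⟩
        rw [S.msg_of_firstDeviation hk hkj, S.msg_of_firstDeviation hk' hkj, h k hkj]
    · rfl
    · change ∀ k, S.last p.1 k < S.last p.1 j → _ at h
      simp only [msg]
      by_cases hj : j = p.1
      · subst hj
        simp only [S.last_lt] at h
        have : (∀ k, k ≠ p.1 → x k = a k) ↔ ∀ k, k ≠ p.1 → x' k = a k :=
          forall_congr' fun k => forall_congr' fun hk => by rw [h k hk]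
        simp only [this]
      · rw [if_neg hj, if_neg hj]
  msg_surjective := by
    rintro i (_ | b)
    · exact ⟨Sum.inr (Sum.inl i), S.ref, by simp [msg]⟩
    · exact ⟨Sum.inr (Sum.inr (⟨i, b⟩, S.ref)), S.ref, by simp [msg]⟩
  chance
    | Sum.inl (a, r) => α a * S.θ a r
    | Sum.inr _ => 0

/-- The players follow recommendations, and otherwise respond to the reference profile. -/
def instruction (i : I) : Option (A i) → A i
  | some b => b
  | none => S.best i

/-- The profile that results if everyone complies. -/
def base : State A → (i : I) → A i
  | Sum.inl (a, _) => a
  | Sum.inr (Sum.inl _) => S.ref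
  -- Here the others reach `a` by trembling, not by complying; it is the profile on which the belief
  -- of the player moving last is to rest.
  | Sum.inr (Sum.inr (_, a)) => a

/-- The outcome of a deviation. -/
def out : State A → (i : I) → A i → (i : I) → A i
  -- Choosing the recommended action is not a deviation and triggers no punishment.
  | Sum.inl (a, r), i, c => if c = a i then a else S.punish a r i c
  | Sum.inr ω, i, c => Function.update (S.base (Sum.inr ω)) i c

theorem out_self (ω : State A) (i : I) (c : A i) : S.out ω i c i = c := by
  rcases ω with ⟨a, r⟩ | ω
  · rw [out]
    split
    · rename_i h; exact h.symm
    · exact S.punish_self _ _ _ _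
  · simp [out]

theorem chance_nonneg (ω : State A) : 0 ≤ S.mediator.chance ω := by
  rcases ω with ⟨a, r⟩ | ω
  · exact mul_nonneg (S.mem.1 a) ((S.θ_mem a).1 r)
  · exact le_rfl

theorem sum_chance_mul (F : State A → ℝ) :
    ∑ ω, S.mediator.chance ω * F ω = ∑ a, ∑ r, α a * S.θ a r * F (Sum.inl (a, r)) := by
  rw [Fintype.sum_sum_type, Fintype.sum_prod_type, Finset.sum_eq_zero (s := Finset.univ)
    (f := fun ω => S.mediator.chance (Sum.inr ω) * F (Sum.inr ω)), add_zero]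
  · rfl
  · intro ω _
    exact zero_mul _

theorem chance_mem : S.mediator.chance ∈ stdSimplex ℝ (State A) := by
  refine ⟨S.chance_nonneg, ?_⟩
  have h := S.sum_chance_mul fun _ => 1
  simp only [mul_one] at h
  rw [h, ← S.mem.2]
  refine Finset.sum_congr rfl fun a _ => ?_
  rw [← Finset.mul_sum, (S.θ_mem a).2, mul_one]

theorem base_eq {ω : State A} (hω : S.mediator.chance ω ≠ 0) (i : I) :
    S.base ω i = S.instruction i (S.mediator.msg ω i (S.base ω)) := by
  rcases ω with ⟨a, r⟩ | ω
  · change a i = S.instruction i (S.msg (Sum.inl (a, r)) i a)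
    rw [S.msg_of_comply fun _ _ => rfl]
    rfl
  · exact absurd rfl hω

/-- Everyone after `i` is recommended his part of the punishment, because `i` is the first deviator
and `punish` agrees with `a` before him; so obeying produces exactly that profile. -/
theorem follows_inl (a : (i : I) → A i) (r : Enumeration I) (i : I) (c : A i) :
    S.mediator.Follows S.instruction (Sum.inl (a, r)) i a (S.out (Sum.inl (a, r)) i c) := by
  by_cases hc : c = a i
  · simp only [out, if_pos hc]
    refine ⟨fun _ _ => rfl, fun j _ => ?_⟩
    change a j = S.instruction j (S.msg (Sum.inl (a, r)) j a)
    rw [S.msg_of_comply fun _ _ => rfl]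
    rfl
  · simp only [out, if_neg hc]
    refine ⟨fun j hj => S.punish_before a r i c j hj, fun j hj => ?_⟩
    have h : FirstDeviation a r (S.punish a r i c) i :=
      ⟨by rwa [S.punish_self], fun l hl => S.punish_before a r i c l hl⟩
    change _ = S.instruction j (S.msg (Sum.inl (a, r)) j _)
    rw [S.msg_of_firstDeviation h hj, S.punish_self]
    rfl

/-- When `i` moves last nobody reacts to him, and only his own coordinate changes. -/
theorem follows_of_last {ω : State A} {i : I} (h : S.ord ω = S.last i) (a : (i : I) → A i)
    (c : A i) : S.mediator.Follows S.instruction ω i a (Function.update a i c) := by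
  constructor
  · intro j hj
    change S.ord ω j < S.ord ω i at hj
    rw [h, S.last_lt] at hj
    rw [Function.update_of_ne hj]
  · intro j hj
    change S.ord ω i < S.ord ω j at hj
    rw [h] at hj
    by_cases hji : j = i
    · subst hji
      exact absurd hj (lt_irrefl _)
    · exact absurd ((S.last_lt i j).2 hji) (not_lt.2 hj.le)

theorem msg_base_of_chance_ne_zero {ω : State A} (hω : S.mediator.chance ω ≠ 0) (i : I) :
    S.mediator.msg ω i (S.base ω) = some (S.base ω i) := by
  rcases ω with ⟨a, r⟩ | ω
  · exact S.msg_of_comply fun _ _ => rfl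
  · exact absurd rfl hω

theorem follows_base {ω : State A} (hω : S.mediator.chance ω ≠ 0) (i : I) (c : A i) :
    S.mediator.Follows S.instruction ω i (S.base ω) (S.out ω i c) := by
  rcases ω with ⟨a, r⟩ | ω
  · exact S.follows_inl a r i c
  · exact absurd rfl hω

/-- The ICE inequality read as optimality given the recommendation `b`. For `c = b` it is an
equality, since nothing is punished. -/
theorem optimal_of_chance (i : I) (b c : A i) :
    ∑ ω, (if S.base ω i = b then S.mediator.chance ω else 0) * u i (S.out ω i c) ≤
      ∑ ω, (if S.base ω i = b then S.mediator.chance ω else 0) * u i (S.base ω) := by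
  have hrw : ∀ F : State A → ℝ,
      ∑ ω, (if S.base ω i = b then S.mediator.chance ω else 0) * F ω =
        ∑ a with a i = b, α a * ∑ r, S.θ a r * F (Sum.inl (a, r)) := by
    intro F
    have h := S.sum_chance_mul fun ω => if S.base ω i = b then F ω else 0
    simp only [mul_ite, mul_zero] at h
    simp only [ite_mul, zero_mul]
    rw [h, Finset.sum_filter]
    refine Finset.sum_congr rfl fun a _ => ?_
    by_cases hab : a i = b
    · simp only [base, hab, if_true, Finset.mul_sum, mul_assoc]
    · simp [base, hab]
  rw [hrw, hrw]
  by_cases hc : c = b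
  · subst hc
    refine le_of_eq (Finset.sum_congr rfl fun a ha => ?_)
    rw [Finset.mem_filter] at ha
    simp only [out, base, ha.2, if_true]
  · refine le_trans (le_of_eq ?_) ((S.compatible i b c).trans (le_of_eq ?_))
    · refine Finset.sum_congr rfl fun a ha => ?_
      rw [Finset.mem_filter] at ha
      simp only [out, ha.2, if_neg hc]
    · refine Finset.sum_congr rfl fun a ha => ?_
      simp only [base]
      rw [← Finset.sum_mul, (S.θ_mem a).2, one_mul]

open Classical in
theorem dist_eq (a : (i : I) → A i) :
    α a = ∑ ω with S.base ω = a, S.mediator.chance ω := by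
  have h := S.sum_chance_mul fun ω => if S.base ω = a then 1 else 0
  simp only [mul_ite, mul_one, mul_zero] at h
  rw [Finset.sum_filter]
  refine Eq.trans ?_ h.symm
  have h1 : ∀ a', ∑ r, (if S.base (Sum.inl (a', r)) = a then α a' * S.θ a' r else 0) =
      if a' = a then α a' else 0 := by
    intro a'
    by_cases ha : a' = a
    · simp only [base, ha, if_true, ← Finset.mul_sum, (S.θ_mem a).2, mul_one]
    · simp [base, ha]
  simp only [h1]
  simp

variable [∀ i, Nontrivial (A i)]

theorem nashImplementable (S : Scheme u α) : NashImplementable u α := by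
  have : Nonempty (State A) := ⟨Sum.inl (S.ref, Fintype.equivFin I)⟩
  refine Mediator.nashImplementable u S.chance_mem S.instruction S.base
    (fun ω hω i => S.base_eq hω i) (fun a => ?_) S.out S.out_self (fun ω hω i c =>
      S.follows_base hω i c) fun i κ c => ?_
  · exact S.dist_eq a
  · rw [Finset.sum_filter, Finset.sum_filter]
    rcases κ with _ | b
    · rw [Finset.sum_eq_zero, Finset.sum_eq_zero]
      all_goals
        intro ω _
        by_cases h0 : S.mediator.chance ω = 0
        · rw [h0, zero_mul, ite_self]
        · rw [if_neg (by rw [S.msg_base_of_chance_ne_zero h0]; simp)]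
    · refine le_trans (le_of_eq ?_) ((S.optimal_of_chance i b c).trans (le_of_eq ?_))
      all_goals
        refine Finset.sum_congr rfl fun ω _ => ?_
        by_cases h0 : S.mediator.chance ω = 0
        · simp [h0]
        · simp only [S.msg_base_of_chance_ne_zero h0, Option.some_inj, ite_mul, zero_mul]

end Scheme

end

end ChoiceInterdependence

/-! ### Trembles of graded orders, consistency and optimality -/

namespace ChoiceInterdependence
namespace Scheme

/-- The scale of the trembles. -/
noncomputable def scale (n : ℕ) : ℝ := 1 / (n + 2)

theorem scale_pos (n : ℕ) : 0 < scale n := by unfold scale; positivity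

theorem scale_lt_one (n : ℕ) : scale n < 1 := by
  unfold scale
  rw [div_lt_one (by positivity)]
  have : (0 : ℝ) ≤ n := n.cast_nonneg
  linarith

theorem tendsto_scale : Tendsto scale atTop (𝓝 0) := by
  have h := (tendsto_one_div_add_atTop_nhds_zero_nat (𝕜 := ℝ)).comp (tendsto_add_atTop_nat 1)
  refine h.congr fun n => ?_
  simp only [Function.comp, scale, Nat.cast_add, Nat.cast_one]
  congr 1
  ring

theorem tendsto_zero_of_le_scale {f : ℕ → ℝ} (k : ℝ) (h0 : ∀ n, 0 ≤ f n)
    (h : ∀ n, f n ≤ k * scale n) : Tendsto f atTop (𝓝 0) := by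
  refine squeeze_zero h0 h ?_
  simpa using tendsto_scale.const_mul k

variable {I : Type w} [Fintype I] [DecidableEq I] {A : I → Type w} [∀ i, Fintype (A i)]
  [∀ i, DecidableEq (A i)] [∀ i, Nontrivial (A i)]
  {u : I → ((i : I) → A i) → ℝ} {α : ((i : I) → A i) → ℝ} (S : Scheme u α)

/-- The probability of a tremble after a message. -/
noncomputable def rate (n : ℕ) {i : I} : Option (A i) → ℝ
  | none => scale n
  | some _ => scale n ^ (Fintype.card I + 3)

theorem rate_pos (n : ℕ) {i : I} (κ : Option (A i)) : 0 < rate n κ := by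
  cases κ
  · exact scale_pos n
  · exact pow_pos (scale_pos n) _

theorem rate_le (n : ℕ) {i : I} (κ : Option (A i)) : rate n κ ≤ scale n := by
  cases κ
  · exact le_rfl
  · exact pow_le_of_le_one (scale_pos n).le (scale_lt_one n).le (by omega)

theorem tendsto_rate {i : I} (κ : Option (A i)) : Tendsto (fun n => rate n κ) atTop (𝓝 0) :=
  tendsto_zero_of_le_scale 1 (fun n => (rate_pos n κ).le) fun n => by
    rw [one_mul]; exact rate_le n κ

/-- Responses with trembles. -/
noncomputable def tremble (n : ℕ) (i : I) (κ : Option (A i)) (c : A i) : ℝ :=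
  (1 - rate n κ) * Mediator.pureResponse S.instruction i κ c + rate n κ * (Fintype.card (A i) : ℝ)⁻¹

theorem card_pos' (i : I) : (0 : ℝ) < Fintype.card (A i) := by
  exact_mod_cast Fintype.card_pos

theorem le_tremble (n : ℕ) (i : I) (κ : Option (A i)) (c : A i) :
    rate n κ * (Fintype.card (A i) : ℝ)⁻¹ ≤ S.tremble n i κ c := by
  have h1 := (Mediator.pureResponse_mem S.instruction i κ).1 c
  have h2 : 0 ≤ 1 - rate n κ := by linarith [rate_le n κ, scale_lt_one n]
  rw [tremble]
  linarith [mul_nonneg h2 h1]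

theorem tremble_pos (n : ℕ) (i : I) (κ : Option (A i)) (c : A i) : 0 < S.tremble n i κ c :=
  (mul_pos (rate_pos n κ) (inv_pos.2 (card_pos' i))).trans_le (S.le_tremble n i κ c)

theorem tremble_mem (n : ℕ) (i : I) (κ : Option (A i)) : S.tremble n i κ ∈ stdSimplex ℝ (A i) := by
  refine ⟨fun c => (S.tremble_pos n i κ c).le, ?_⟩
  simp only [tremble]
  rw [Finset.sum_add_distrib, ← Finset.mul_sum, (Mediator.pureResponse_mem S.instruction i κ).2,
    Finset.sum_const, Finset.card_univ, nsmul_eq_mul]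
  have := (card_pos' (A := A) i).ne'
  field_simp
  ring

theorem tremble_le_one (n : ℕ) (i : I) (κ : Option (A i)) (c : A i) : S.tremble n i κ c ≤ 1 := by
  rw [← (S.tremble_mem n i κ).2]
  exact Finset.single_le_sum (fun c _ => (S.tremble_pos n i κ c).le) (Finset.mem_univ c)

theorem tremble_le_rate (n : ℕ) (i : I) (κ : Option (A i)) {c : A i} (hc : c ≠ S.instruction i κ) :
    S.tremble n i κ c ≤ rate n κ := by
  rw [tremble, Mediator.pureResponse, Pi.single_eq_of_ne hc, mul_zero, zero_add]
  refine mul_le_of_le_one_right (rate_pos n κ).le (inv_le_one_of_one_le₀ ?_)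
  exact_mod_cast Fintype.card_pos

theorem tendsto_tremble (i : I) (κ : Option (A i)) (c : A i) :
    Tendsto (fun n => S.tremble n i κ c) atTop
      (𝓝 (Mediator.pureResponse S.instruction i κ c)) := by
  have h := (((tendsto_const_nhds (x := (1 : ℝ))).sub (tendsto_rate κ)).mul_const
    (Mediator.pureResponse S.instruction i κ c)).add
    ((tendsto_rate κ).mul_const (Fintype.card (A i) : ℝ)⁻¹)
  rw [sub_zero, one_mul, zero_mul, add_zero] at h
  exact h

theorem prod_tremble_nonneg (n : ℕ) (s : Finset I) (κ : (j : I) → Option (A j))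
    (x : (i : I) → A i) : 0 ≤ ∏ j ∈ s, S.tremble n j (κ j) (x j) :=
  Finset.prod_nonneg fun j _ => (S.tremble_pos n j _ _).le

theorem prod_tremble_le_one (n : ℕ) (s : Finset I) (κ : (j : I) → Option (A j))
    (x : (i : I) → A i) : ∏ j ∈ s, S.tremble n j (κ j) (x j) ≤ 1 :=
  Finset.prod_le_one (fun j _ => (S.tremble_pos n j _ _).le) fun j _ => S.tremble_le_one n j _ _

theorem prod_tremble_le {n : ℕ} {s : Finset I} (κ : (j : I) → Option (A j))
    (x : (i : I) → A i) {k : I} (hk : k ∈ s) :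
    ∏ j ∈ s, S.tremble n j (κ j) (x j) ≤ S.tremble n k (κ k) (x k) := by
  rw [← Finset.mul_prod_erase s _ hk]
  exact mul_le_of_le_one_right (S.tremble_pos n k _ _).le (S.prod_tremble_le_one n _ κ x)

/-- The probability that the others tremble to the actions in `a` if they are not told anything. -/
noncomputable def reach (n : ℕ) (i : I) (a : (i : I) → A i) : ℝ :=
  ∏ j ∈ Finset.univ.erase i, S.tremble n j none (a j)

theorem reach_pos (n : ℕ) (i : I) (a : (i : I) → A i) : 0 < S.reach n i a :=
  Finset.prod_pos fun j _ => S.tremble_pos n j none (a j)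

/-- Each of the uninformed others trembles to a given action with probability at least `scale n`
over the number of his actions. The absent factor of `i` is at most one, so the full power of the
scale may be used. This keeps the weights divided by `reach` small. -/
theorem pow_div_reach_le (n : ℕ) (i : I) (a : (i : I) → A i) :
    scale n ^ Fintype.card I / S.reach n i a ≤ ∏ j, (Fintype.card (A j) : ℝ) := by
  rw [div_le_iff₀ (S.reach_pos n i a), ← div_le_iff₀' (Finset.prod_pos fun j _ => card_pos' j)]
  have h1 : scale n ^ Fintype.card I / ∏ j, (Fintype.card (A j) : ℝ) =
      ∏ j : I, scale n * (Fintype.card (A j) : ℝ)⁻¹ := by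
    rw [Finset.prod_mul_distrib, Finset.prod_const, Finset.prod_inv_distrib, Finset.card_univ,
      div_eq_mul_inv]
  have h0 : ∀ j : I, 0 ≤ scale n * (Fintype.card (A j) : ℝ)⁻¹ := fun j =>
    mul_nonneg (scale_pos n).le (inv_nonneg.2 (card_pos' j).le)
  rw [h1, ← Finset.mul_prod_erase _ _ (Finset.mem_univ i)]
  have h2 : scale n * (Fintype.card (A i) : ℝ)⁻¹ ≤ 1 :=
    mul_le_one₀ (scale_lt_one n).le (inv_nonneg.2 (card_pos' i).le)
      (inv_le_one_of_one_le₀ (by exact_mod_cast Fintype.card_pos))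
  refine (mul_le_of_le_one_left (Finset.prod_nonneg fun j _ => h0 j) h2).trans ?_
  exact Finset.prod_le_prod (fun j _ => h0 j) fun j _ => S.le_tremble n j none (a j)

/-- Weights of the states. -/
noncomputable def weight (n : ℕ) : State A → ℝ
  | Sum.inl (a, r) => α a * S.θ a r + scale n ^ (Fintype.card I + 3)
  | Sum.inr (Sum.inl _) => scale n
  | Sum.inr (Sum.inr (p, a)) =>
    scale n ^ (Fintype.card I + 2) * (S.belief p.1 p.2 a + scale n) / S.reach n p.1 a

theorem weight_pos (n : ℕ) (ω : State A) : 0 < S.weight n ω := by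
  have h := scale_pos n
  rcases ω with ⟨a, r⟩ | i | ⟨p, a⟩
  · exact add_pos_of_nonneg_of_pos (mul_nonneg (S.mem.1 a) ((S.θ_mem a).1 r)) (pow_pos h _)
  · exact h
  · exact div_pos (mul_pos (pow_pos h _)
      (add_pos_of_nonneg_of_pos ((S.belief_mem _ _).1 a) h)) (S.reach_pos n _ a)

theorem tendsto_scale_pow {k : ℕ} (hk : k ≠ 0) : Tendsto (fun n => scale n ^ k) atTop (𝓝 0) := by
  simpa [hk] using tendsto_scale.pow k

/-- A second-order bound: two powers of the scale remain after `reach` is absorbed. Justifying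
states are therefore negligible next to the state of order `scale n` behind silence. -/
theorem weight_justifying_le (n : ℕ) (p : Σ i, A i) (a : (i : I) → A i) :
    S.weight n (Sum.inr (Sum.inr (p, a))) ≤
      (∏ j, (Fintype.card (A j) : ℝ)) * (S.belief p.1 p.2 a + 1) * scale n * scale n := by
  have h0 := scale_pos n
  have h1 := scale_lt_one n
  have h2 := (S.belief_mem p.1 p.2).1 a
  have h3 : S.weight n (Sum.inr (Sum.inr (p, a))) = scale n ^ Fintype.card I / S.reach n p.1 a *
      (S.belief p.1 p.2 a + scale n) * scale n * scale n := by
    rw [weight]; ring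
  rw [h3]
  have h4 := S.pow_div_reach_le n p.1 a
  have h5 : (0 : ℝ) ≤ ∏ j, (Fintype.card (A j) : ℝ) := Finset.prod_nonneg fun j _ => (card_pos' j).le
  gcongr

theorem tendsto_weight (ω : State A) :
    Tendsto (fun n => S.weight n ω) atTop (𝓝 (S.mediator.chance ω)) := by
  rcases ω with ⟨a, r⟩ | i | ⟨p, a⟩
  · have h := (tendsto_scale_pow (k := Fintype.card I + 3) (by omega)).const_add (α a * S.θ a r)
    rw [add_zero] at h
    exact h
  · exact tendsto_scale
  · refine tendsto_zero_of_le_scale ((∏ j, (Fintype.card (A j) : ℝ)) * (S.belief p.1 p.2 a + 1))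
      (fun n => (S.weight_pos n _).le) fun n => (S.weight_justifying_le n p a).trans ?_
    have h2 := (S.belief_mem p.1 p.2).1 a
    have h5 : (0 : ℝ) ≤ ∏ j, (Fintype.card (A j) : ℝ) :=
      Finset.prod_nonneg fun j _ => (card_pos' j).le
    refine mul_le_of_le_one_right ?_ (scale_lt_one n).le
    have := (scale_pos n).le
    positivity

theorem tendsto_sum_weight : Tendsto (fun n => ∑ ω, S.weight n ω) atTop (𝓝 1) := by
  rw [← S.chance_mem.2]
  exact tendsto_finsetSum _ fun ω _ => S.tendsto_weight ω

theorem sum_weight_pos (n : ℕ) : 0 < ∑ ω, S.weight n ω :=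
  Finset.sum_pos (fun ω _ => S.weight_pos n ω) ⟨Sum.inl (S.ref, Fintype.equivFin I), by simp⟩

/-- The recommendation of `b` occurs. -/
def OnPath (α : ((i : I) → A i) → ℝ) (i : I) (b : A i) : Prop := ∃ a, 0 < α a ∧ a i = b

open Classical in
/-- The order of magnitude of the probability of an information set. -/
noncomputable def magnitude (α : ((i : I) → A i) → ℝ) (i : I) : Option (A i) → ℕ → ℝ
  | none, n => scale n
  | some b, n => if OnPath α i b then 1 else scale n ^ (Fintype.card I + 2)

open Classical in
/-- The asymptotic weights of the states at an information set. -/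
noncomputable def likelihood (i : I) : Option (A i) → State A → ℝ
  | none, ω => if ω = Sum.inr (Sum.inl i) then 1 else 0
  | some b, ω => if OnPath α i b then (if S.base ω i = b then S.mediator.chance ω else 0)
    else match ω with
      | Sum.inr (Sum.inr (p, a)) => if p = ⟨i, b⟩ then S.belief i b a else 0
      | _ => 0

theorem filter_last {ω : State A} {i : I} (h : S.ord ω = S.last i) :
    (Finset.univ.filter fun j => S.ord ω j < S.ord ω i) = Finset.univ.erase i := by
  ext j
  simp [h, S.last_lt]

theorem prod_pureResponse (x y : (i : I) → A i) (s : Finset I) :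
    ∏ j ∈ s, Mediator.pureResponse S.instruction j (some (y j)) (x j) =
      if ∀ j ∈ s, y j = x j then 1 else 0 := by
  split
  · rename_i h
    refine Finset.prod_eq_one fun j hj => ?_
    rw [← h j hj]
    exact Pi.single_eq_same _ _
  · rename_i h
    push Not at h
    obtain ⟨j, hj, hne⟩ := h
    exact Finset.prod_eq_zero hj (Pi.single_eq_of_ne hne.symm _)

/-- A player who is told nothing attributes it to the state in which he alone is uninformed, and
expects the others to follow `ref`. The justifying states weigh less by a factor of the scale. -/
theorem tendsto_uninformed (i : I) (ω : State A) (x : (i : I) → A i)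
    (h : S.msg ω i x = none) : Tendsto (fun n => (scale n)⁻¹ * (S.weight n ω *
        ∏ j with S.ord ω j < S.ord ω i, S.tremble n j (S.msg ω j x) (x j))) atTop
      (𝓝 (if ∀ j, S.ord ω j < S.ord ω i → S.base ω j = x j then S.likelihood i none ω else 0)) := by
  rcases ω with ⟨a, r⟩ | k | ⟨p, a⟩
  · rw [msg] at h
    split at h <;> simp at h
  · obtain rfl : i = k := by
      by_contra hk
      simp [msg, hk] at h
    have h1 : ∀ n, (scale n)⁻¹ * (S.weight n (Sum.inr (Sum.inl i)) *
        ∏ j with S.ord (Sum.inr (Sum.inl i)) j < S.ord (Sum.inr (Sum.inl i)) i,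
          S.tremble n j (S.msg (Sum.inr (Sum.inl i)) j x) (x j)) =
        ∏ j ∈ Finset.univ.erase i, S.tremble n j (some (S.ref j)) (x j) := by
      intro n
      rw [weight, inv_mul_cancel_left₀ (scale_pos n).ne',
        S.filter_last (ω := Sum.inr (Sum.inl i)) (i := i) rfl]
      refine Finset.prod_congr rfl fun j hj => ?_
      rw [msg, if_neg (Finset.ne_of_mem_erase hj)]
    simp only [h1]
    have h2 := tendsto_finsetProd (Finset.univ.erase i) fun j _ =>
      S.tendsto_tremble j (some (S.ref j)) (x j)
    rw [S.prod_pureResponse] at h2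
    convert h2 using 2
    simp only [ord, S.last_lt, likelihood, if_true, base, Finset.mem_erase, Finset.mem_univ,
      and_true]
  · have h1 : S.likelihood i none (Sum.inr (Sum.inr (p, a))) = 0 := by simp [likelihood]
    rw [h1, ite_self]
    have hC : (0 : ℝ) ≤ ∏ j, (Fintype.card (A j) : ℝ) :=
      Finset.prod_nonneg fun j _ => (card_pos' j).le
    have hb := (S.belief_mem p.1 p.2).1 a
    refine tendsto_zero_of_le_scale ((∏ j, (Fintype.card (A j) : ℝ)) * (S.belief p.1 p.2 a + 1))
      (fun n => mul_nonneg (inv_nonneg.2 (scale_pos n).le) (mul_nonneg (S.weight_pos n _).le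
        (S.prod_tremble_nonneg n _ _ x))) fun n => ?_
    rw [inv_mul_le_iff₀ (scale_pos n), mul_comm (scale n)]
    exact (mul_le_of_le_one_right (S.weight_pos n _).le (S.prod_tremble_le_one n _ _ x)).trans
      (S.weight_justifying_le n p a)

/-- No rescaling is needed, as the information set is reached. Punishments that happen to recommend
`b` require a deviation and vanish in the limit. -/
theorem tendsto_onPath (i : I) {b : A i} (hb : OnPath α i b) (ω : State A) (x : (i : I) → A i)
    (h : S.msg ω i x = some b) : Tendsto (fun n => S.weight n ω *
        ∏ j with S.ord ω j < S.ord ω i, S.tremble n j (S.msg ω j x) (x j)) atTop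
      (𝓝 (if ∀ j, S.ord ω j < S.ord ω i → S.base ω j = x j then
        S.likelihood i (some b) ω else 0)) := by
  have h1 := (S.tendsto_weight ω).mul (tendsto_finsetProd
    (Finset.univ.filter fun j => S.ord ω j < S.ord ω i) fun j _ =>
      S.tendsto_tremble j (S.msg ω j x) (x j))
  convert h1 using 2
  simp only [likelihood, if_pos hb]
  rcases ω with ⟨a, r⟩ | ω
  · by_cases hx : ∀ j, S.ord (Sum.inl (a, r)) j < S.ord (Sum.inl (a, r)) i →
        S.base (Sum.inl (a, r)) j = x j
    · have hcomply : ∀ j, r j < r i → x j = a j := fun j hj => (hx j hj).symm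
      rw [S.msg_of_comply hcomply, Option.some_inj] at h
      have h' : S.base (Sum.inl (a, r)) i = b := h
      rw [if_pos hx, if_pos h', Finset.prod_eq_one, mul_one]
      intro j hj
      have hj' : r j < r i := (Finset.mem_filter.1 hj).2
      rw [S.msg_of_comply fun k hk => hcomply k (hk.trans hj'), hcomply j hj']
      exact Pi.single_eq_same _ _
    · rw [if_neg hx]
      obtain ⟨k, hk, hki⟩ := exists_firstDeviation (a := a) (x := x) (r := r) (i := i)
        fun hx' => hx fun j hj => (hx' j hj).symm
      -- The first deviator disobeyed his recommendation `a k`, which has limiting probability zero.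
      rw [Finset.prod_eq_zero (i := k) (Finset.mem_filter.2 ⟨Finset.mem_univ k, hki⟩), mul_zero]
      rw [S.msg_of_comply hk.2]
      exact Pi.single_eq_of_ne hk.1 _
  · have h0 : S.mediator.chance (Sum.inr ω) = 0 := rfl
    simp [h0]

/-- Ordinary states send `b` only if `α a = 0` or after a tremble against a recommendation, both of
order `card I + 3` in the scale. The justifying states for `b` have order `card I + 2` and prevail;
dividing their weight by `reach` makes the posterior equal to `belief`, whatever the probabilities
of the trembles. -/
theorem tendsto_offPath (i : I) {b : A i} (hb : ¬ OnPath α i b) (ω : State A) (x : (i : I) → A i)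
    (h : S.msg ω i x = some b) : Tendsto (fun n => (scale n ^ (Fintype.card I + 2))⁻¹ *
      (S.weight n ω * ∏ j with S.ord ω j < S.ord ω i, S.tremble n j (S.msg ω j x) (x j))) atTop
      (𝓝 (if ∀ j, S.ord ω j < S.ord ω i → S.base ω j = x j then
        S.likelihood i (some b) ω else 0)) := by
  have hpow := fun n => pow_pos (scale_pos n) (Fintype.card I + 2)
  -- The remaining states can only recommend `ref`, which is on path, and so cannot have sent `b`.
  have href : S.ref i ≠ b := fun h => hb ⟨S.ref, S.ref_pos, h⟩
  rcases ω with ⟨a, r⟩ | k | ⟨⟨k, b'⟩, a⟩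
  · have h1 : S.likelihood i (some b) (Sum.inl (a, r)) = 0 := by simp [likelihood, hb]
    rw [h1, ite_self]
    have hα := S.mem.1 a
    have hθ := (S.θ_mem a).1 r
    refine tendsto_zero_of_le_scale (α a * S.θ a r + 1)
      (fun n => mul_nonneg (inv_nonneg.2 (hpow n).le) (mul_nonneg (S.weight_pos n _).le
        (S.prod_tremble_nonneg n _ _ x))) fun n => ?_
    rw [inv_mul_le_iff₀ (hpow n)]
    have hs : scale n ^ (Fintype.card I + 3) ≤ 1 :=
      pow_le_one₀ (scale_pos n).le (scale_lt_one n).le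
    by_cases hx : ∀ j, r j < r i → x j = a j
    · rw [S.msg_of_comply hx, Option.some_inj] at h
      have h0 : α a = 0 := by
        by_contra h0
        exact hb ⟨a, lt_of_le_of_ne hα (Ne.symm h0), h⟩
      refine (mul_le_of_le_one_right (S.weight_pos n _).le
        (S.prod_tremble_le_one n _ _ x)).trans (le_of_eq ?_)
      rw [weight, h0]
      ring
    · obtain ⟨k, hk, hki⟩ := exists_firstDeviation hx
      have h2 : ∏ j with S.ord (Sum.inl (a, r)) j < S.ord (Sum.inl (a, r)) i,
          S.tremble n j (S.msg (Sum.inl (a, r)) j x) (x j) ≤ scale n ^ (Fintype.card I + 3) := by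
        refine (S.prod_tremble_le _ x (k := k) (Finset.mem_filter.2 ⟨Finset.mem_univ k, hki⟩)).trans ?_
        rw [S.msg_of_comply hk.2]
        exact S.tremble_le_rate n k _ hk.1
      calc _ ≤ (α a * S.θ a r + 1) * scale n ^ (Fintype.card I + 3) := by
            refine mul_le_mul ?_ h2 (S.prod_tremble_nonneg n _ _ x) (by positivity)
            rw [weight]
            linarith
        _ = _ := by ring
  · by_cases hk : i = k
    · subst hk
      simp [msg] at h
    · simp only [msg, if_neg hk, Option.some_inj] at h
      exact absurd h href
  · by_cases hk : i = k
    swap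
    · simp [msg, hk] at h
    subst hk
    by_cases hx : ∀ k, k ≠ i → x k = a k
    swap
    · simp only [msg, if_true, if_neg hx, Option.some_inj] at h
      exact absurd h href
    simp only [msg, if_true, if_pos hx, Option.some_inj, Function.update_self] at h
    subst h
    have h1 : ∀ n, (scale n ^ (Fintype.card I + 2))⁻¹ *
        (S.weight n (Sum.inr (Sum.inr (⟨i, b'⟩, a))) *
        ∏ j with S.ord (Sum.inr (Sum.inr (⟨i, b'⟩, a))) j <
            S.ord (Sum.inr (Sum.inr (⟨i, b'⟩, a))) i,
          S.tremble n j (S.msg (Sum.inr (Sum.inr (⟨i, b'⟩, a))) j x) (x j)) =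
        S.belief i b' a + scale n := by
      intro n
      have h2 : ∏ j with S.ord (Sum.inr (Sum.inr (⟨i, b'⟩, a))) j <
            S.ord (Sum.inr (Sum.inr (⟨i, b'⟩, a))) i,
          S.tremble n j (S.msg (Sum.inr (Sum.inr (⟨i, b'⟩, a))) j x) (x j) = S.reach n i a := by
        rw [S.filter_last (ω := Sum.inr (Sum.inr (⟨i, b'⟩, a))) (i := i) rfl, reach]
        refine Finset.prod_congr rfl fun j hj => ?_
        have hj' := Finset.ne_of_mem_erase hj
        rw [hx j hj']
        simp only [msg, if_neg hj']
      rw [h2, weight, div_mul_cancel₀ _ (S.reach_pos n i a).ne',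
        inv_mul_cancel_left₀ (hpow n).ne']
    simp only [h1]
    have h3 := tendsto_scale.const_add (S.belief i b' a)
    rw [add_zero] at h3
    convert h3 using 2
    rw [if_pos]
    · simp [likelihood, hb]
    · intro j hj
      simp only [ord, S.last_lt] at hj
      exact (hx j hj).symm

theorem sum_likelihood_offPath (i : I) {b : A i} (hb : ¬ OnPath α i b) (F : State A → ℝ) :
    ∑ ω, S.likelihood i (some b) ω * F ω =
      ∑ a, S.belief i b a * F (Sum.inr (Sum.inr (⟨i, b⟩, a))) := by
  simp only [likelihood, if_neg hb]
  rw [Fintype.sum_sum_type, Fintype.sum_sum_type, Fintype.sum_prod_type]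
  simp only [zero_mul, Finset.sum_const_zero, zero_add, ite_mul]
  rw [Fintype.sum_prod_type, Finset.sum_comm]
  simp

theorem sum_likelihood_none (i : I) (F : State A → ℝ) :
    ∑ ω, S.likelihood i none ω * F ω = F (Sum.inr (Sum.inl i)) := by
  simp only [likelihood, ite_mul, one_mul, zero_mul]
  simp

theorem likelihood_supported (i : I) (κ : Option (A i)) (ω : State A)
    (h : S.likelihood i κ ω ≠ 0) : S.mediator.msg ω i (S.base ω) = κ ∧
      ∀ c, S.mediator.Follows S.instruction ω i (S.base ω) (S.out ω i c) := by
  rcases κ with _ | b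
  · obtain rfl : ω = Sum.inr (Sum.inl i) := by
      by_contra hω
      simp [likelihood, hω] at h
    refine ⟨?_, fun c => S.follows_of_last rfl _ c⟩
    change S.msg (Sum.inr (Sum.inl i)) i S.ref = none
    simp [msg]
  · by_cases hb : OnPath α i b
    · simp only [likelihood, if_pos hb, ne_eq, ite_eq_right_iff, Classical.not_imp] at h
      exact ⟨by rw [S.msg_base_of_chance_ne_zero h.2, h.1], fun c => S.follows_base h.2 i c⟩
    · rcases ω with ⟨a, r⟩ | k | ⟨p, a⟩
      · simp [likelihood, hb] at h
      · simp [likelihood, hb] at h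
      · obtain rfl : p = ⟨i, b⟩ := by
          by_contra hp
          simp [likelihood, hb, hp] at h
        refine ⟨?_, fun c => S.follows_of_last rfl _ c⟩
        change S.msg (Sum.inr (Sum.inr (⟨i, b⟩, a))) i a = some b
        simp [msg]

theorem sum_likelihood_pos (i : I) (κ : Option (A i)) : 0 < ∑ ω, S.likelihood i κ ω := by
  rcases κ with _ | b
  · have h := S.sum_likelihood_none i fun _ => 1
    simp only [mul_one] at h
    rw [h]
    exact one_pos
  · by_cases hb : OnPath α i b
    · simp only [likelihood, if_pos hb]
      obtain ⟨a, ha, rfl⟩ := hb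
      obtain ⟨r, -, hr⟩ : ∃ r ∈ Finset.univ, 0 < S.θ a r := by
        refine Finset.exists_lt_of_sum_lt (f := fun _ => (0 : ℝ)) ?_
        rw [(S.θ_mem a).2]
        simp
      refine Finset.sum_pos' (fun ω _ => ?_) ⟨Sum.inl (a, r), Finset.mem_univ _, ?_⟩
      · split
        · exact S.chance_nonneg ω
        · exact le_rfl
      · have h : S.base (Sum.inl (a, r)) i = a i := rfl
        rw [if_pos h]
        exact mul_pos ha hr
    · have h := S.sum_likelihood_offPath i hb fun _ => 1
      simp only [mul_one] at h
      rw [h, (S.belief_mem i b).2]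
      exact one_pos

/-- Each kind of message has its own reason: silence is answered by a best response to `ref`, an
on-path recommendation is protected by the ICE inequality, and an off-path one is justified by
`belief`. -/
theorem optimal (i : I) (κ : Option (A i)) (c : A i) :
    ∑ ω, S.likelihood i κ ω * u i (S.out ω i c) ≤
      ∑ ω, S.likelihood i κ ω * u i (S.out ω i (S.instruction i κ)) := by
  rcases κ with _ | b
  · rw [sum_likelihood_none, sum_likelihood_none]
    exact S.best_best i c
  · by_cases hb : OnPath α i b
    · simp only [likelihood, if_pos hb]
      refine (S.optimal_of_chance i b c).trans_eq (Finset.sum_congr rfl fun ω _ => ?_)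
      by_cases h : S.base ω i = b
      · rcases ω with ⟨a, r⟩ | ω
        · have h' : a i = b := h
          simp [base, out, instruction, h']
        · have h0 : S.mediator.chance (Sum.inr ω) = 0 := rfl
          simp [h0]
      · simp [h]
    · rw [S.sum_likelihood_offPath i hb, S.sum_likelihood_offPath i hb]
      exact S.belief_best i b c

theorem sequentiallyImplementable (S : Scheme u α) : SequentiallyImplementable u α := by
  have : Nonempty (State A) := ⟨Sum.inl (S.ref, Fintype.equivFin I)⟩
  refine Mediator.sequentiallyImplementable u S.chance_mem S.instruction S.base
    (fun ω hω i => S.base_eq hω i) (fun a => ?_) ?_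
  · exact S.dist_eq a
  have hmag : ∀ i (κ : Option (A i)) n, magnitude α i κ n ≠ 0 := by
    intro i κ n
    rcases κ with _ | b
    · exact (scale_pos n).ne'
    · rw [magnitude]
      split
      · exact one_ne_zero
      · exact (pow_pos (scale_pos n) _).ne'
  refine Mediator.exists_isSequentialEquilibrium u S.chance_mem S.instruction S.base S.out
    S.out_self (fun n ω => S.weight n ω / ∑ ω, S.weight n ω) (fun n =>
      ⟨fun ω => div_nonneg (S.weight_pos n ω).le (S.sum_weight_pos n).le, ?_⟩)
    (fun n ω => div_pos (S.weight_pos n ω) (S.sum_weight_pos n)) (fun ω => ?_)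
    S.tremble S.tremble_mem S.tremble_pos S.tendsto_tremble
    (fun i κ n => (magnitude α i κ n)⁻¹) (fun i κ n => inv_ne_zero (hmag i κ n)) S.likelihood
    (fun i κ ω x h => ?_) S.likelihood_supported S.sum_likelihood_pos S.optimal
  · rw [← Finset.sum_div, div_self (S.sum_weight_pos n).ne']
  · have h := (S.tendsto_weight ω).div S.tendsto_sum_weight one_ne_zero
    rw [div_one] at h
    exact h
  · have h1 : Tendsto (fun n => (magnitude α i κ n)⁻¹ * (S.weight n ω *
        ∏ j with S.ord ω j < S.ord ω i, S.tremble n j (S.msg ω j x) (x j))) atTop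
        (𝓝 (if ∀ j, S.ord ω j < S.ord ω i → S.base ω j = x j then
          S.likelihood i κ ω else 0)) := by
      rcases κ with _ | b
      · exact S.tendsto_uninformed i ω x h
      · by_cases hb : OnPath α i b
        · simp only [magnitude, if_pos hb, inv_one, one_mul]
          exact S.tendsto_onPath i hb ω x h
        · simp only [magnitude, if_neg hb]
          exact S.tendsto_offPath i hb ω x h
    -- The weights are not normalized, but their sum tends to one, so normalizing leaves the limits
    -- unchanged.
    have h2 := h1.div S.tendsto_sum_weight one_ne_zero
    rw [div_one] at h2
    convert h2 using 2 with n
    · simp only [Pi.div_apply]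
      change _ * (_ / _ * ∏ j with S.ord ω j < S.ord ω i,
        S.tremble n j (S.msg ω j x) (x j)) = _
      ring
    · rfl

end Scheme
end ChoiceInterdependence

/-! ### The corollary -/

theorem mainTheorem5 {I : Type w} [Fintype I] [DecidableEq I] {A : I → Type w}
    [∀ i, Fintype (A i)] [∀ i, DecidableEq (A i)] [∀ i, Nontrivial (A i)]
    (u : I → ((i : I) → A i) → ℝ)
    (hdom : ∀ (i : I) (b : A i), ¬ ChoiceInterdependence.StrictlyDominated u i b)
    (α : ((i : I) → A i) → ℝ) (hα : α ∈ stdSimplex ℝ ((i : I) → A i)) :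
    (ChoiceInterdependence.SequentiallyImplementable u α ↔ ChoiceInterdependence.IsICE u α) ∧
      (ChoiceInterdependence.NashImplementable u α ↔
        ChoiceInterdependence.SequentiallyImplementable u α) := by
  refine ⟨⟨fun h => h.isICE hα, fun h => ?_⟩, ⟨fun h => ?_, fun h => ?_⟩⟩
  · obtain ⟨S⟩ := h.exists_scheme hdom
    exact S.sequentiallyImplementable
  · obtain ⟨S⟩ := (h.isICE hα).exists_scheme hdom
    exact S.sequentiallyImplementable
  · obtain ⟨S⟩ := (h.isICE hα).exists_scheme hdom
    exact S.nashImplementable
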